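/- Let $q\in\mathbb C\setminus\{0\}$ be generic, i.e. $q^k\neq 1$ for all $k\ge 1$, and put $\omega=q-q^{-1}$ and $k_q=(q^k-q^{-k})/(q-q^{-1})$. Let $V=\mathbb C^N$ and let $R=\|R_{ij}^{kl}\|$ be (the matrix of) an operator on $V^{\otimes 2}$, $R(x_i\otimes x_j)=\sum_{k,l} R_{ij}^{kl}\,x_k\otimes x_l$. The lower indices number the rows of a matrix, the upper ones its columns. Assume: * $R$ is a Hecke symmetry: $R_{12}R_{23}R_{12}=R_{23}R_{12}R_{23}$ on $V^{\otimes 3}$ and $(qI-R)(q^{-1}I+R)=0$; * $R$ is skew-invertible: there is $\Psi$ on $V^{\otimes 2}$ with $\mathrm{Tr}_{(2)}(R_{12}\Psi_{23})=P_{13}=\mathrm{Tr}_{(2)}(\Psi_{12}R_{23})$, where $P$ is the flip; * $R$ is even of bi-rank $(m|0)$: the $R$-skew-symmetric algebra $T(V)/\langle \mathrm{Im}(q^{-1}I+R)\rangle$ is finite dimensional and its Hilbert–Poincaré series is a polynomial of degree $m$. Let $C_i^j=\sum_a\Psi_{ia}^{ja}$, and for a matrix $M$ on $V^{\otimes n}$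 (with entries in any complex algebra) let $\langle M\rangle_{1\dots n}=\mathrm{Tr}(C_1C_2\cdots C_nM)$, where $C_k$ is $C$ acting on the $k$-th factor. Write $R_k$ for $R$ acting on the factors $k,k+1$. Let $\mathcal L(R)$ be the reflection equation algebra, the unital associative $\mathbb C$-algebra generated by $l_i^j$, $1\le i,j\le N$, with the relations $$R\,(L\otimes I)\,R\,(L\otimes I)=(L\otimes I)\,R\,(L\otimes I)\,R,\qquad L=\|l_i^j\|,$$ and let $L_{\overline 1}=L\otimes I^{\otimes(n-1)}$, $L_{\overline{k+1}}=R_kL_{\overline k}R_k^{-1}$. Let $\mathcal H_n(q)$ be the Hecke algebra with generators $\tau_1,\dots,\tau_{n-1}$ and the relations $\tau_i\tau_{i+1}\tau_i=\tau_{i+1}\tau_i\tau_{i+1}$, $\tau_i\tau_j=\tau_j\tau_i$ for $|i-j|\ge2$, and $(q-\tau_i)(q^{-1}+\tau_i)=0$. Let $\rho_R:\mathcal H_n(q)\to\mathrm{End}(V^{\otimes n})$, $\tau_k\mapsto R_k$, be its $R$-matrix representation, and put $$ch(z)=\langle\rho_R(z)\,L_{\overline1}L_{\overline2}\cdots L_{\overline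 n}\rangle_{1\dots n}\in\mathcal L(R),\qquad z\in\mathcal H_n(q).$$ For $n\ge1$ define the elementary symmetric polynomials $a_n=ch(e^{(1^n)})$, the power sums of the first kind $p_n=ch(\tau_{n-1}\cdots\tau_1)$ and the power sums of the second kind $t_n=ch(\tau_{n-1}^{-1}\cdots\tau_1^{-1})$. Here $e^{(1^n)}\in\mathcal H_n(q)$ is the primitive idempotent of the one-column partition $(1^n)$, i.e. the $q$-antisymmetrizer $A^{(n)}$ given by $A^{(1)}=1$ and $A^{(k+1)}=\frac1{(k+1)_q}A^{(k)}\big(q^k-k_q\tau_k\big)A^{(k)}$. Then the generating functions $$A(x)=1+\sum_{k=1}^m a_kx^k,\qquad P(x)=\sum_{k=1}^\infty p_kx^k,\qquad T(x)=\sum_{k=1}^\infty t_kx^k$$ satisfy, as formal power series in $x$ with coefficients in $\mathcal L(R)$, the relations $$\omega A(qx)P(-x)=A(x/q)-A(qx),\qquad \omega A(x/q)T(-x)=A(x/q)-A(qx),\qquad P(x)=T(x)+\omega P(x)T(x).$$ -/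

import Mathlib

/-! ### Tensor powers of `V = ℂ^N`: matrices indexed by multi-indices `J → Fin N` -/

/-- The operator acting by `M` on the tensor factors `s 0, s 1, …` and by the identity on all the
other factors. -/
def onLegs {N : ℕ} {κ J : Type} [Fintype J] [DecidableEq J] [Fintype κ] (s : κ → J)
    (M : Matrix (κ → Fin N) (κ → Fin N) ℂ) : Matrix (J → Fin N) (J → Fin N) ℂ :=
  open Classical in
  Matrix.of fun f g => if ∀ j, j ∉ Set.range s → f j = g j then M (f ∘ s) (g ∘ s) else 0

/-- An `N² × N²` matrix `R = ‖R_{ij}^{kl}‖` (row `(i,j)`, column `(k,l)`) as a matrix indexed by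
multi-indices of length two. -/
def twoLegs {N : ℕ} (R : Matrix (Fin N × Fin N) (Fin N × Fin N) ℂ) :
    Matrix (Fin 2 → Fin N) (Fin 2 → Fin N) ℂ :=
  R.submatrix (fun u => (u 0, u 1)) (fun u => (u 0, u 1))

/-- The matrix `R_{i+1} = I^{⊗ i} ⊗ R ⊗ I^{⊗ (p-1-i)}` on `V^{⊗ (p+1)}`, for `0 ≤ i < p`: it acts on
the factors number `i+1` and `i+2`. -/
def braidMatrix {N : ℕ} (R : Matrix (Fin N × Fin N) (Fin N × Fin N) ℂ) {p : ℕ} (i : Fin p) :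
    Matrix (Fin (p + 1) → Fin N) (Fin (p + 1) → Fin N) ℂ :=
  onLegs ![i.castSucc, i.succ] (twoLegs R)

/-- Braid relation `R₁₂ R₂₃ R₁₂ = R₂₃ R₁₂ R₂₃` on `V^{⊗ 3}` and the Hecke condition
`(q I - R) (q⁻¹ I + R) = 0`. -/
structure IsHeckeSymmetry {N : ℕ} (q : ℂ) (R : Matrix (Fin N × Fin N) (Fin N × Fin N) ℂ) :
    Prop where
  braid : braidMatrix R (0 : Fin 2) * braidMatrix R 1 * braidMatrix R 0 =
    braidMatrix R (1 : Fin 2) * braidMatrix R 0 * braidMatrix R 1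
  hecke : (q • (1 : Matrix (Fin N × Fin N) (Fin N × Fin N) ℂ) - R) * (q⁻¹ • 1 + R) = 0

/-- `Tr₍₂₎ (R₁₂ Ψ₂₃) = P₁₃ = Tr₍₂₎ (Ψ₁₂ R₂₃)`, written in matrix entries. -/
structure IsSkewInverse {N : ℕ} (R Ψ : Matrix (Fin N × Fin N) (Fin N × Fin N) ℂ) : Prop where
  left : ∀ i j k l, ∑ a, ∑ b, R (i, a) (j, b) * Ψ (b, k) (a, l) =
    if i = l ∧ k = j then 1 else 0
  right : ∀ i j k l, ∑ a, ∑ b, Ψ (i, a) (j, b) * R (b, k) (a, l) =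
    if i = l ∧ k = j then 1 else 0

/-! ### The `R`-skew-symmetric algebra and the bi-rank -/

/-- The quadratic relations `Im (q⁻¹ I + R) ⊂ V ⊗ V`: all the elements
`∑_{a,b} (q⁻¹ I + R)_{ij}^{ab} x_a ⊗ x_b` are set to zero. -/
inductive SkewRel {N : ℕ} (q : ℂ) (R : Matrix (Fin N × Fin N) (Fin N × Fin N) ℂ) :
    FreeAlgebra ℂ (Fin N) → FreeAlgebra ℂ (Fin N) → Prop
  | rel (i j : Fin N) : SkewRel q R
      (∑ a, ∑ b, (q⁻¹ • (1 : Matrix (Fin N × Fin N) (Fin N × Fin N) ℂ) + R) (i, j) (a, b) •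
        (FreeAlgebra.ι ℂ a * FreeAlgebra.ι ℂ b)) 0

/-- The `R`-skew-symmetric algebra `T(V) / ⟨Im (q⁻¹ I + R)⟩`. -/
abbrev SkewAlgebra {N : ℕ} (q : ℂ) (R : Matrix (Fin N × Fin N) (Fin N × Fin N) ℂ) : Type :=
  RingQuot (SkewRel q R)

/-- The homogeneous component of degree `k` of the `R`-skew-symmetric algebra: the span of the
monomials of length `k` in the generators. -/
noncomputable def skewComponent {N : ℕ} (q : ℂ) (R : Matrix (Fin N × Fin N) (Fin N × Fin N) ℂ)
    (k : ℕ) : Submodule ℂ (SkewAlgebra q R) :=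
  Submodule.span ℂ (Set.range fun w : Fin k → Fin N =>
    (List.ofFn fun j => RingQuot.mkAlgHom ℂ (SkewRel q R) (FreeAlgebra.ι ℂ (w j))).prod)

/-- The Hilbert–Poincaré series of the `R`-skew-symmetric algebra. -/
noncomputable def skewHilbertSeries {N : ℕ} (q : ℂ)
    (R : Matrix (Fin N × Fin N) (Fin N × Fin N) ℂ) : PowerSeries ℕ :=
  PowerSeries.mk fun k => Module.finrank ℂ (skewComponent q R k)

/-- `R` is even of bi-rank `(m|0)`: its skew-symmetric algebra is finite dimensional and the
Hilbert–Poincaré series of this algebra is a polynomial of degree `m`. -/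
structure IsEvenOfBirank {N : ℕ} (q : ℂ) (R : Matrix (Fin N × Fin N) (Fin N × Fin N) ℂ)
    (m : ℕ) : Prop where
  finite : Module.Finite ℂ (SkewAlgebra q R)
  degree : ∃ h : Polynomial ℕ, h.degree = m ∧ (h : PowerSeries ℕ) = skewHilbertSeries q R

/-! ### The Hecke algebra -/

/-- The defining relations of the Hecke algebra on `p + 1` strands; the generator with index
`i : Fin p` is Artin's generator `τ_{i+1}`. -/
inductive HeckeRel (q : ℂ) (p : ℕ) : FreeAlgebra ℂ (Fin p) → FreeAlgebra ℂ (Fin p) → Prop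
  | braid (i j : Fin p) (h : (i : ℕ) + 1 = j) : HeckeRel q p
      (FreeAlgebra.ι ℂ i * FreeAlgebra.ι ℂ j * FreeAlgebra.ι ℂ i)
      (FreeAlgebra.ι ℂ j * FreeAlgebra.ι ℂ i * FreeAlgebra.ι ℂ j)
  | comm (i j : Fin p) (h : (i : ℕ) + 2 ≤ j) : HeckeRel q p
      (FreeAlgebra.ι ℂ i * FreeAlgebra.ι ℂ j) (FreeAlgebra.ι ℂ j * FreeAlgebra.ι ℂ i)
  | hecke (i : Fin p) : HeckeRel q p
      ((q • 1 - FreeAlgebra.ι ℂ i) * (q⁻¹ • 1 + FreeAlgebra.ι ℂ i)) 0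

/-- The Hecke algebra `H_{p+1}(q)`. -/
abbrev HeckeAlgebra (q : ℂ) (p : ℕ) : Type := RingQuot (HeckeRel q p)

/-- The generator `τ_{i+1}` of `H_{p+1}(q)`. -/
noncomputable def heckeGen (q : ℂ) {p : ℕ} (i : Fin p) : HeckeAlgebra q p :=
  RingQuot.mkAlgHom ℂ (HeckeRel q p) (FreeAlgebra.ι ℂ i)

/-- The `q`-number `n_q = (qⁿ - q⁻ⁿ) / (q - q⁻¹)`. -/
noncomputable def qNumber (q : ℂ) (n : ℕ) : ℂ := (q ^ n - q⁻¹ ^ n) / (q - q⁻¹)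

/-- The `q`-antisymmetrizer `A^{(k)}` on the first `k = j + 1` strands of `H_{p+1}(q)`:
`A^{(1)} = 1` and `A^{(k+1)} = (1 / (k+1)_q) A^{(k)} (q^k - k_q τ_k) A^{(k)}`. -/
noncomputable def antisymmetrizer (q : ℂ) (p : ℕ) (j : Fin (p + 1)) : HeckeAlgebra q p :=
  Fin.induction (motive := fun _ => HeckeAlgebra q p) 1
    (fun i A => (qNumber q (i + 2))⁻¹ •
      (A * (q ^ ((i : ℕ) + 1) • 1 - qNumber q (i + 1) • heckeGen q i) * A)) j

/-- The primitive idempotent `e^{(1^n)}` of `H_n(q)`, `n = p + 1`, of the one-column partition,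
on which every generator `τ_i` acts as `-q⁻¹`. -/
noncomputable def columnIdempotent (q : ℂ) (p : ℕ) : HeckeAlgebra q p :=
  antisymmetrizer q p (Fin.last p)

/-! ### The `R`-matrix representation of the Hecke algebra -/

section Legs

variable {N : ℕ} {κ J : Type} [Fintype J] [DecidableEq J] [Fintype κ]

theorem onLegs_mul [DecidableEq κ] {s : κ → J} (hs : Function.Injective s)
    (M M' : Matrix (κ → Fin N) (κ → Fin N) ℂ) :
    onLegs s M * onLegs s M' = onLegs s (M * M') := by
  classical
  ext f g
  simp only [onLegs, Matrix.mul_apply, Matrix.of_apply]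
  by_cases hfg : ∀ j, j ∉ Set.range s → f j = g j
  · rw [if_pos hfg]
    symm
    refine Fintype.sum_of_injective (fun u : κ → Fin N => Function.extend s u f) ?_ _ _ ?_ ?_
    · intro u v huv
      funext k
      have := congrFun huv (s k)
      simpa [hs.extend_apply] using this
    · intro h hh
      rw [if_neg, zero_mul]
      intro hfh
      refine hh ⟨h ∘ s, ?_⟩
      funext j
      by_cases hj : j ∈ Set.range s
      · obtain ⟨k, rfl⟩ := hj
        simp [hs.extend_apply]
      · rw [← hfh j hj]
        exact Function.extend_apply' _ _ _ (by simpa using hj)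
    · intro u
      have h1 : ∀ j, j ∉ Set.range s → Function.extend s u f j = f j := fun j hj =>
        Function.extend_apply' _ _ _ (by simpa using hj)
      have h2 : Function.extend s u f ∘ s = u := by
        funext k
        simp [hs.extend_apply]
      rw [if_pos (fun j hj => (h1 j hj).symm), if_pos (fun j hj => (h1 j hj).trans (hfg j hj)), h2]
  · rw [if_neg hfg]
    refine Finset.sum_eq_zero fun h _ => ?_
    by_cases h1 : ∀ j, j ∉ Set.range s → f j = h j
    · have h2 : ¬ ∀ j, j ∉ Set.range s → h j = g j := fun h2 =>
        hfg fun j hj => (h1 j hj).trans (h2 j hj)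
      rw [if_neg h2, mul_zero]
    · rw [if_neg h1, zero_mul]

theorem onLegs_one [DecidableEq κ] (s : κ → J) :
    onLegs s (1 : Matrix (κ → Fin N) (κ → Fin N) ℂ) = 1 := by
  classical
  ext f g
  simp only [onLegs, Matrix.of_apply, Matrix.one_apply]
  by_cases h : f = g
  · subst h
    simp
  · rw [if_neg h]
    split_ifs with h1 h2
    · refine absurd ?_ h
      funext j
      by_cases hj : j ∈ Set.range s
      · obtain ⟨k, rfl⟩ := hj
        exact congrFun h2 k
      · exact h1 j hj
    · rfl
    · rfl

theorem onLegs_add (s : κ → J) (M M' : Matrix (κ → Fin N) (κ → Fin N) ℂ) :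
    onLegs s (M + M') = onLegs s M + onLegs s M' := by
  ext f g
  simp only [onLegs, Matrix.of_apply, Matrix.add_apply]
  split_ifs <;> simp

theorem onLegs_smul (s : κ → J) (c : ℂ) (M : Matrix (κ → Fin N) (κ → Fin N) ℂ) :
    onLegs s (c • M) = c • onLegs s M := by
  ext f g
  simp only [onLegs, Matrix.of_apply, Matrix.smul_apply]
  split_ifs <;> simp

theorem onLegs_onLegs {J' : Type} [Fintype J'] [DecidableEq J'] {s : κ → J} {t : J → J'}
    (ht : Function.Injective t) (M : Matrix (κ → Fin N) (κ → Fin N) ℂ) :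
    onLegs t (onLegs s M) = onLegs (t ∘ s) M := by
  classical
  ext f g
  simp only [onLegs, Matrix.of_apply, ← ite_and]
  refine if_congr ⟨?_, ?_⟩ rfl rfl
  · rintro ⟨h1, h2⟩ j hj
    by_cases hjt : j ∈ Set.range t
    · obtain ⟨k, rfl⟩ := hjt
      refine h2 k ?_
      rintro ⟨l, rfl⟩
      exact hj ⟨l, rfl⟩
    · exact h1 j hjt
  · intro h
    refine ⟨fun j hj => h j ?_, fun j hj => h (t j) ?_⟩
    · rintro ⟨l, rfl⟩
      exact hj ⟨s l, rfl⟩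
    · rintro ⟨l, hl⟩
      exact hj ⟨l, ht hl⟩

theorem onLegs_comm {κ' : Type} [Fintype κ'] {s : κ → J} {t : κ' → J}
    (hst : ∀ k l, s k ≠ t l) (M : Matrix (κ → Fin N) (κ → Fin N) ℂ)
    (M' : Matrix (κ' → Fin N) (κ' → Fin N) ℂ) :
    onLegs s M * onLegs t M' = onLegs t M' * onLegs s M := by
  classical
  have key : ∀ {κ₁ κ₂ : Type} [Fintype κ₁] [Fintype κ₂] (s : κ₁ → J) (t : κ₂ → J)
      (_ : ∀ k l, s k ≠ t l) (M : Matrix (κ₁ → Fin N) (κ₁ → Fin N) ℂ)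
      (M' : Matrix (κ₂ → Fin N) (κ₂ → Fin N) ℂ) (f g : J → Fin N),
      (onLegs s M * onLegs t M') f g =
        if ∀ j, j ∉ Set.range s → j ∉ Set.range t → f j = g j then
          M (f ∘ s) (g ∘ s) * M' (f ∘ t) (g ∘ t) else 0 := by
    intro κ₁ κ₂ _ _ s t hst M M' f g
    simp only [onLegs, Matrix.mul_apply, Matrix.of_apply]
    have hs : (fun j => if j ∈ Set.range s then g j else f j) ∘ s = g ∘ s := by
      funext k
      simp
    have ht : (fun j => if j ∈ Set.range s then g j else f j) ∘ t = f ∘ t := by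
      funext l
      have : t l ∉ Set.range s := by
        rintro ⟨k, hk⟩
        exact hst k l hk
      exact if_neg this
    rw [Finset.sum_eq_single (fun j => if j ∈ Set.range s then g j else f j)]
    · rw [if_pos (fun j hj => by simp only [if_neg hj]), hs, ht]
      by_cases h : ∀ j, j ∉ Set.range s → j ∉ Set.range t → f j = g j
      · rw [if_pos h, if_pos]
        intro j hj
        by_cases hjs : j ∈ Set.range s
        · simp only [if_pos hjs]
        · simp only [if_neg hjs]
          exact h j hjs hj
      · rw [if_neg h, if_neg, mul_zero]
        intro h'
        refine h fun j hjs hjt => ?_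
        have := h' j hjt
        simpa only [if_neg hjs] using this
    · intro h _ hne
      by_cases h1 : ∀ j, j ∉ Set.range s → f j = h j
      · have h2 : ¬ ∀ j, j ∉ Set.range t → h j = g j := by
          intro h2
          refine hne ?_
          funext j
          by_cases hjs : j ∈ Set.range s
          · simp only [if_pos hjs]
            refine h2 j ?_
            rintro ⟨l, rfl⟩
            obtain ⟨k, hk⟩ := hjs
            exact hst k l hk
          · simp only [if_neg hjs]
            exact (h1 j hjs).symm
        rw [if_neg h2, mul_zero]
      · rw [if_neg h1, zero_mul]
    · intro h
      exact absurd (Finset.mem_univ _) h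
  ext f g
  rw [key s t hst, key t s (fun l k => (hst k l).symm)]
  refine if_congr ⟨fun h j a b => h j b a, fun h j a b => h j b a⟩ (mul_comm _ _) rfl

end Legs

theorem twoLegs_mul {N : ℕ} (R R' : Matrix (Fin N × Fin N) (Fin N × Fin N) ℂ) :
    twoLegs R * twoLegs R' = twoLegs (R * R') :=
  Matrix.submatrix_mul_equiv R R' _ (finTwoArrowEquiv (Fin N)) _

theorem twoLegs_one {N : ℕ} :
    twoLegs (1 : Matrix (Fin N × Fin N) (Fin N × Fin N) ℂ) = 1 :=
  Matrix.submatrix_one_equiv (finTwoArrowEquiv (Fin N))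

theorem braidMatrix_hecke {N : ℕ} {q : ℂ} {R : Matrix (Fin N × Fin N) (Fin N × Fin N) ℂ}
    (hR : IsHeckeSymmetry q R) {p : ℕ} (i : Fin p) :
    (q • 1 - braidMatrix R i) * (q⁻¹ • 1 + braidMatrix R i) = 0 := by
  have hinj : Function.Injective ![i.castSucc, i.succ] := by
    intro a b hab
    fin_cases a <;> fin_cases b <;> simp_all [Fin.ext_iff]
  have h1 : q • 1 - braidMatrix R i = onLegs ![i.castSucc, i.succ] (twoLegs (q • 1 - R)) := by
    have : twoLegs (q • 1 - R) = q • 1 + (-1 : ℂ) • twoLegs R := by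
      rw [← twoLegs_one]
      ext u v
      simp [twoLegs, sub_eq_add_neg]
    rw [this, onLegs_add, onLegs_smul, onLegs_smul, onLegs_one, braidMatrix, neg_one_smul,
      sub_eq_add_neg]
  have h2 : q⁻¹ • 1 + braidMatrix R i =
      onLegs ![i.castSucc, i.succ] (twoLegs (q⁻¹ • 1 + R)) := by
    have : twoLegs (q⁻¹ • 1 + R) = q⁻¹ • 1 + twoLegs R := by
      rw [← twoLegs_one]
      ext u v
      simp [twoLegs]
    rw [this, onLegs_add, onLegs_smul, onLegs_one, braidMatrix]
  rw [h1, h2, onLegs_mul hinj, twoLegs_mul, hR.hecke]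
  ext f g
  simp [onLegs, twoLegs]

theorem braidMatrix_braid {N : ℕ} {q : ℂ} {R : Matrix (Fin N × Fin N) (Fin N × Fin N) ℂ}
    (hR : IsHeckeSymmetry q R) {p : ℕ} (i j : Fin p) (h : (i : ℕ) + 1 = j) :
    braidMatrix R i * braidMatrix R j * braidMatrix R i =
      braidMatrix R j * braidMatrix R i * braidMatrix R j := by
  have hinj : Function.Injective ![i.castSucc, i.succ, j.succ] := by
    intro a b hab
    fin_cases a <;> fin_cases b <;> simp_all [Fin.ext_iff] <;> omega
  have h1 : braidMatrix R i =
      onLegs ![i.castSucc, i.succ, j.succ] (braidMatrix R (0 : Fin 2)) := by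
    rw [braidMatrix, braidMatrix, onLegs_onLegs hinj]
    congr 1
    funext a
    fin_cases a <;> simp
  have h2 : braidMatrix R j =
      onLegs ![i.castSucc, i.succ, j.succ] (braidMatrix R (1 : Fin 2)) := by
    rw [braidMatrix, braidMatrix, onLegs_onLegs hinj]
    congr 1
    funext a
    fin_cases a <;> simp [Fin.ext_iff, h]
  rw [h1, h2]
  simp only [onLegs_mul hinj]
  rw [hR.braid]

theorem braidMatrix_comm {N : ℕ} (R : Matrix (Fin N × Fin N) (Fin N × Fin N) ℂ) {p : ℕ}
    (i j : Fin p) (h : (i : ℕ) + 2 ≤ j) :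
    braidMatrix R i * braidMatrix R j = braidMatrix R j * braidMatrix R i := by
  refine onLegs_comm ?_ _ _
  intro a b
  fin_cases a <;> fin_cases b <;> simp [Fin.ext_iff] <;> omega

/-- The `R`-matrix representation `ρ_R : H_{p+1}(q) → End (V^{⊗ (p+1)})`, `τ_i ↦ R_i`. -/
noncomputable def heckeRep {N : ℕ} {q : ℂ} {R : Matrix (Fin N × Fin N) (Fin N × Fin N) ℂ}
    (hR : IsHeckeSymmetry q R) (p : ℕ) :
    HeckeAlgebra q p →ₐ[ℂ] Matrix (Fin (p + 1) → Fin N) (Fin (p + 1) → Fin N) ℂ :=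
  RingQuot.liftAlgHom ℂ ⟨FreeAlgebra.lift ℂ fun i => braidMatrix R i, by
    intro x y hxy
    cases hxy with
    | braid i j h => simpa using braidMatrix_braid hR i j h
    | comm i j h => simpa using braidMatrix_comm R i j h
    | hecke i => simpa using braidMatrix_hecke hR i⟩

/-! ### The reflection equation algebra -/

/-- A complex matrix viewed as a matrix over a complex algebra `𝓐`. -/
def scalarMatrix {ι : Type} (𝓐 : Type) [Semiring 𝓐] [Algebra ℂ 𝓐] (M : Matrix ι ι ℂ) :
    Matrix ι ι 𝓐 :=
  M.map (algebraMap ℂ 𝓐)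

/-- The matrix `L ⊗ I` over the free algebra on the symbols `l_i^j`. -/
noncomputable def freeLOne (N : ℕ) :
    Matrix (Fin N × Fin N) (Fin N × Fin N) (FreeAlgebra ℂ (Fin N × Fin N)) :=
  Matrix.of fun r c => if r.2 = c.2 then FreeAlgebra.ι ℂ (r.1, c.1) else 0

/-- The matrix `R` over the free algebra on the symbols `l_i^j`. -/
noncomputable def freeR {N : ℕ} (R : Matrix (Fin N × Fin N) (Fin N × Fin N) ℂ) :
    Matrix (Fin N × Fin N) (Fin N × Fin N) (FreeAlgebra ℂ (Fin N × Fin N)) :=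
  scalarMatrix _ R

/-- The relations `R (L ⊗ I) R (L ⊗ I) = (L ⊗ I) R (L ⊗ I) R`, entry by entry. -/
inductive RERel {N : ℕ} (R : Matrix (Fin N × Fin N) (Fin N × Fin N) ℂ) :
    FreeAlgebra ℂ (Fin N × Fin N) → FreeAlgebra ℂ (Fin N × Fin N) → Prop
  | rel (r c : Fin N × Fin N) : RERel R
      ((freeR R * freeLOne N * freeR R * freeLOne N) r c)
      ((freeLOne N * freeR R * freeLOne N * freeR R) r c)

/-- The reflection equation algebra `𝓛(R)`. -/
abbrev REAlgebra {N : ℕ} (R : Matrix (Fin N × Fin N) (Fin N × Fin N) ℂ) : Type :=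
  RingQuot (RERel R)

/-- The generator `l_i^j` of the reflection equation algebra. -/
noncomputable def reGen {N : ℕ} (R : Matrix (Fin N × Fin N) (Fin N × Fin N) ℂ) (i j : Fin N) :
    REAlgebra R :=
  RingQuot.mkAlgHom ℂ (RERel R) (FreeAlgebra.ι ℂ (i, j))

/-- The copy `L_{\bar k}`, `k = j + 1`, of the generating matrix on `p + 1` tensor factors:
`L_{\bar 1} = L ⊗ I^{⊗ p}` and `L_{\overline{k+1}} = R_k L_{\bar k} R_k⁻¹`. -/
noncomputable def reCopy {N : ℕ} (R : Matrix (Fin N × Fin N) (Fin N × Fin N) ℂ) (p : ℕ)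
    (j : Fin (p + 1)) :
    Matrix (Fin (p + 1) → Fin N) (Fin (p + 1) → Fin N) (REAlgebra R) :=
  Fin.induction
    (motive := fun _ => Matrix (Fin (p + 1) → Fin N) (Fin (p + 1) → Fin N) (REAlgebra R))
    (Matrix.of fun f g => if ∀ a, a ≠ 0 → f a = g a then reGen R (f 0) (g 0) else 0)
    (fun i M => scalarMatrix _ (braidMatrix R i) * M * scalarMatrix _ (braidMatrix R i)⁻¹) j

/-- The product `L_{\bar 1} L_{\bar 2} ⋯ L_{\overline{p+1}}`. -/
noncomputable def reProduct {N : ℕ} (R : Matrix (Fin N × Fin N) (Fin N × Fin N) ℂ) (p : ℕ) :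
    Matrix (Fin (p + 1) → Fin N) (Fin (p + 1) → Fin N) (REAlgebra R) :=
  (List.ofFn fun j => reCopy R p j).prod

/-- The matrix `C_i^j = ∑_a Ψ_{ia}^{ja}`. -/
def traceMatrix {N : ℕ} (Ψ : Matrix (Fin N × Fin N) (Fin N × Fin N) ℂ) :
    Matrix (Fin N) (Fin N) ℂ :=
  Matrix.of fun i j => ∑ a, Ψ (i, a) (j, a)

/-- The multiple `R`-trace `⟨M⟩_{1…n} = Tr (C₁ C₂ ⋯ C_n M)`, where
`C₁ C₂ ⋯ C_n = C^{⊗ n}` has the entries `∏_a C_{f(a)}^{g(a)}`. -/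
noncomputable def rTrace {N n : ℕ} (Ψ : Matrix (Fin N × Fin N) (Fin N × Fin N) ℂ)
    {𝓐 : Type} [Semiring 𝓐] [Algebra ℂ 𝓐]
    (M : Matrix (Fin n → Fin N) (Fin n → Fin N) 𝓐) : 𝓐 :=
  (scalarMatrix 𝓐 (Matrix.of fun f g : Fin n → Fin N => ∏ a, traceMatrix Ψ (f a) (g a)) *
    M).trace

/-- The map `ch : H_n(q) → 𝓛(R)`, `n = p + 1`,
`ch z = ⟨ρ_R(z) L_{\bar 1} ⋯ L_{\bar n}⟩_{1…n}`. -/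
noncomputable def charMap {N : ℕ} {q : ℂ} {R : Matrix (Fin N × Fin N) (Fin N × Fin N) ℂ}
    (hR : IsHeckeSymmetry q R) (Ψ : Matrix (Fin N × Fin N) (Fin N × Fin N) ℂ) (p : ℕ)
    (z : HeckeAlgebra q p) : REAlgebra R :=
  rTrace Ψ (scalarMatrix _ (heckeRep hR p z) * reProduct R p)

/-- The elementary symmetric polynomials `a_n(L) = ch (e^{(1^n)})`, with `a_0 = 1`. -/
noncomputable def elemSym {N : ℕ} {q : ℂ} {R : Matrix (Fin N × Fin N) (Fin N × Fin N) ℂ}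
    (hR : IsHeckeSymmetry q R) (Ψ : Matrix (Fin N × Fin N) (Fin N × Fin N) ℂ) :
    ℕ → REAlgebra R
  | 0 => 1
  | p + 1 => charMap hR Ψ p (columnIdempotent q p)

/-- The power sums of the first kind `p_n(L) = ch (τ_{n-1} ⋯ τ_1)`, `n ≥ 1`
(the value at `0` is not used). -/
noncomputable def powerSumFirst {N : ℕ} {q : ℂ} {R : Matrix (Fin N × Fin N) (Fin N × Fin N) ℂ}
    (hR : IsHeckeSymmetry q R) (Ψ : Matrix (Fin N × Fin N) (Fin N × Fin N) ℂ) :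
    ℕ → REAlgebra R
  | 0 => 0
  | p + 1 => charMap hR Ψ p (List.ofFn fun i : Fin p => heckeGen q i).reverse.prod

/-- The power sums of the second kind `t_n(L) = ch (τ_{n-1}⁻¹ ⋯ τ_1⁻¹)`, `n ≥ 1`
(the value at `0` is not used). -/
noncomputable def powerSumSecond {N : ℕ} {q : ℂ} {R : Matrix (Fin N × Fin N) (Fin N × Fin N) ℂ}
    (hR : IsHeckeSymmetry q R) (Ψ : Matrix (Fin N × Fin N) (Fin N × Fin N) ℂ) :
    ℕ → REAlgebra R
  | 0 => 0
  | p + 1 => charMap hR Ψ p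
      (List.ofFn fun i : Fin p => Ring.inverse (heckeGen q i)).reverse.prod

/-! ### Generating functions -/

/-- `A(x) = 1 + ∑_{k=1}^m a_k x^k`. -/
noncomputable def genA {N : ℕ} {q : ℂ} {R : Matrix (Fin N × Fin N) (Fin N × Fin N) ℂ}
    (hR : IsHeckeSymmetry q R) (Ψ : Matrix (Fin N × Fin N) (Fin N × Fin N) ℂ) (m : ℕ) :
    PowerSeries (REAlgebra R) :=
  1 + ∑ k ∈ Finset.Icc 1 m, PowerSeries.monomial k (elemSym hR Ψ k)

/-- `P(x) = ∑_{k≥1} p_k x^k`. -/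
noncomputable def genP {N : ℕ} {q : ℂ} {R : Matrix (Fin N × Fin N) (Fin N × Fin N) ℂ}
    (hR : IsHeckeSymmetry q R) (Ψ : Matrix (Fin N × Fin N) (Fin N × Fin N) ℂ) :
    PowerSeries (REAlgebra R) :=
  PowerSeries.mk fun k => if 1 ≤ k then powerSumFirst hR Ψ k else 0

/-- `T(x) = ∑_{k≥1} t_k x^k`. -/
noncomputable def genT {N : ℕ} {q : ℂ} {R : Matrix (Fin N × Fin N) (Fin N × Fin N) ℂ}
    (hR : IsHeckeSymmetry q R) (Ψ : Matrix (Fin N × Fin N) (Fin N × Fin N) ℂ) :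
    PowerSeries (REAlgebra R) :=
  PowerSeries.mk fun k => if 1 ≤ k then powerSumSecond hR Ψ k else 0

/-- The series `F(c x)` for a scalar `c` and a series `F(x)` over a complex algebra. -/
noncomputable def substScalar {𝓐 : Type} [Semiring 𝓐] [Algebra ℂ 𝓐] (c : ℂ)
    (F : PowerSeries 𝓐) : PowerSeries 𝓐 :=
  PowerSeries.mk fun k => c ^ k • PowerSeries.coeff k F

/-! Everything is computed from one family of traces, `hookTrace R Ψ p j X`, the R-trace of `X L_1 ⋯
L_p L_{p+1}^j` (indices number the barred copies). Write ω = q - q⁻¹ and s_j for `tracePower R Ψ j`,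
the R-trace of `L^j`. Two rules remove the last tensor factor. If `X` does not act on that factor,
the trace splits off s_j (`hookTrace_extend`). If `X` contains the last braid matrix once, the
factor disappears and `j` grows by one (`hookTrace_braid_mul`, `hookTrace_conj_braid`). They rest on
the identities Tr₂(C₂R₁₂) = I and Tr₂(C₂R₁₂X₁R₁₂⁻¹) = Tr(CX)·I, on cyclicity of the R-trace for
`ρ_R(H_n)`, and on the fact that `ρ_R(H_n)` commutes with `L_1 ⋯ L_n` by the reflection equation.

Applied to `τ_{n-1} ⋯ τ_1`, the rules give p_n = s_n. For the inverse generators, R⁻¹ = R - ω turns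
them into p_n = t_n + ω ∑ t_k p_{n-k}, that is P = T + ωTP. For the antisymmetrizer, the defining
recursion gives the q-Newton identities n_q a_n = ∑_{k<n} (-1)^{n-1-k} q^k a_k p_{n-k}
(`qNumber_smul_elemSym`). Multiplied by ω, since ω n_q = q^n - q⁻ⁿ, these are the first relation
coefficient by coefficient.

The series A is cut off at degree m, so the identities of degree n > m require a_n = 0. Each column
of `ρ_R(A^{(n)})` is a functional on words that vanishes on the ideal of the skew-symmetric algebra,
hence is zero where that algebra has no component (`heckeRep_columnIdempotent_eq_zero`).

Finally P = T + ωTP says (1 - ωT)(1 + ωP) = 1. A series with constant term 1 is a unit, so the two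
factors commute and P = T + ωPT. Substituting this into A(x/q) = A(qx)(1 + ωP(-x)) gives the second
relation. No commutativity of the coefficients is needed. -/

/-! ### Adjoining a tensor factor and the partial trace over the last factor -/

section Extension

variable {N n : ℕ} {𝓐 : Type}

/-- The multi-index `f` followed by `a`. -/
def addLeg (f : Fin n → Fin N) (a : Fin N) : Fin (n + 1) → Fin N :=
  Fin.snoc (α := fun _ => Fin N) f a

@[simp]
theorem addLeg_last (f : Fin n → Fin N) (a : Fin N) : addLeg f a (Fin.last n) = a := by
  simp [addLeg]

@[simp]
theorem addLeg_castSucc (f : Fin n → Fin N) (a : Fin N) (i : Fin n) :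
    addLeg f a i.castSucc = f i := by
  simp [addLeg]

theorem exists_eq_addLeg (f : Fin (n + 1) → Fin N) : ∃ g a, f = addLeg g a :=
  ⟨Fin.init f, f (Fin.last n), (Fin.snoc_init_self (α := fun _ => Fin N) f).symm⟩

theorem addLeg_inj {f g : Fin n → Fin N} {a b : Fin N} :
    addLeg f a = addLeg g b ↔ f = g ∧ a = b := by
  refine ⟨fun h => ⟨?_, by simpa using congrFun h (Fin.last n)⟩, by rintro ⟨rfl, rfl⟩; rfl⟩
  funext i
  simpa using congrFun h i.castSucc

/-- Multi-indices of length `n + 1` as pairs. -/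
def addLegEquiv (N n : ℕ) : (Fin n → Fin N) × Fin N ≃ (Fin (n + 1) → Fin N) where
  toFun x := addLeg x.1 x.2
  invFun f := (Fin.init f, f (Fin.last n))
  left_inv x := by simp [addLeg]
  right_inv f := Fin.snoc_init_self (α := fun _ => Fin N) f

theorem sum_addLeg {M : Type*} [AddCommMonoid M] (F : (Fin (n + 1) → Fin N) → M) :
    ∑ f, F f = ∑ f, ∑ a, F (addLeg f a) := by
  rw [← (addLegEquiv N n).sum_comp, Fintype.sum_prod_type]
  rfl

theorem matrix_ext_addLeg
    {X Y : Matrix (Fin (n + 1) → Fin N) (Fin (n + 1) → Fin N) 𝓐}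
    (h : ∀ f a g b, X (addLeg f a) (addLeg g b) = Y (addLeg f a) (addLeg g b)) : X = Y := by
  ext f g
  obtain ⟨f, a, rfl⟩ := exists_eq_addLeg f
  obtain ⟨g, b, rfl⟩ := exists_eq_addLeg g
  exact h f a g b

variable [Ring 𝓐]

/-- The matrix `X ⊗ I` on one more tensor factor. -/
def extend (X : Matrix (Fin n → Fin N) (Fin n → Fin N) 𝓐) :
    Matrix (Fin (n + 1) → Fin N) (Fin (n + 1) → Fin N) 𝓐 :=
  Matrix.of fun f g =>
    if f (Fin.last n) = g (Fin.last n) then X (Fin.init f) (Fin.init g) else 0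

@[simp]
theorem extend_apply (X : Matrix (Fin n → Fin N) (Fin n → Fin N) 𝓐) (f g : Fin n → Fin N)
    (a b : Fin N) : extend X (addLeg f a) (addLeg g b) = if a = b then X f g else 0 := by
  simp [extend, addLeg]

theorem extend_mul (X Y : Matrix (Fin n → Fin N) (Fin n → Fin N) 𝓐) :
    extend (X * Y) = extend X * extend Y := by
  refine matrix_ext_addLeg fun f a g b => ?_
  simp [Matrix.mul_apply, sum_addLeg]

theorem extend_one : extend (1 : Matrix (Fin n → Fin N) (Fin n → Fin N) 𝓐) = 1 := by
  refine matrix_ext_addLeg fun f a g b => ?_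
  simp only [extend_apply, Matrix.one_apply, addLeg_inj]
  split_ifs <;> simp_all

theorem extend_add (X Y : Matrix (Fin n → Fin N) (Fin n → Fin N) 𝓐) :
    extend (X + Y) = extend X + extend Y := by
  refine matrix_ext_addLeg fun f a g b => ?_
  simp only [extend_apply, Matrix.add_apply]
  split_ifs <;> simp

theorem extend_list_prod (l : List (Matrix (Fin n → Fin N) (Fin n → Fin N) 𝓐)) :
    extend l.prod = (l.map extend).prod := by
  induction l with
  | nil => simp [extend_one]
  | cons a l ih => simp [extend_mul, ih]

variable [Algebra ℂ 𝓐]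

theorem extend_smul (c : ℂ) (X : Matrix (Fin n → Fin N) (Fin n → Fin N) 𝓐) :
    extend (c • X) = c • extend X := by
  refine matrix_ext_addLeg fun f a g b => ?_
  simp only [extend_apply, Matrix.smul_apply]
  split_ifs <;> simp

theorem extend_scalarMatrix (X : Matrix (Fin n → Fin N) (Fin n → Fin N) ℂ) :
    extend (scalarMatrix 𝓐 X) = scalarMatrix 𝓐 (extend X) := by
  refine matrix_ext_addLeg fun f a g b => ?_
  simp only [scalarMatrix, extend_apply, Matrix.map_apply]
  split_ifs <;> simp

end Extension

/-! ### Complex matrices over a noncommutative algebra. -/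

section Scalar

variable {ι 𝓐 : Type} [Ring 𝓐] [Algebra ℂ 𝓐]

theorem scalarMatrix_mul [Fintype ι] (X Y : Matrix ι ι ℂ) :
    scalarMatrix 𝓐 (X * Y) = scalarMatrix 𝓐 X * scalarMatrix 𝓐 Y :=
  Matrix.map_mul

theorem scalarMatrix_one [DecidableEq ι] : scalarMatrix 𝓐 (1 : Matrix ι ι ℂ) = 1 :=
  Matrix.map_one _ (map_zero _) (map_one _)

theorem scalarMatrix_complex (X : Matrix ι ι ℂ) : scalarMatrix ℂ X = X := by
  ext
  simp [scalarMatrix]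

theorem scalarMatrix_add (X Y : Matrix ι ι ℂ) :
    scalarMatrix 𝓐 (X + Y) = scalarMatrix 𝓐 X + scalarMatrix 𝓐 Y := by
  ext
  simp [scalarMatrix]

theorem scalarMatrix_smul (c : ℂ) (X : Matrix ι ι ℂ) :
    scalarMatrix 𝓐 (c • X) = c • scalarMatrix 𝓐 X := by
  ext
  simp only [scalarMatrix, Matrix.map_apply, Matrix.smul_apply, smul_eq_mul, map_mul]
  rw [Algebra.smul_def]

/-- Cyclicity of the trace fails over a noncommutative algebra. It survives when one factor has
central entries. -/
theorem trace_scalarMatrix_mul_comm [Fintype ι] (X : Matrix ι ι ℂ) (Y : Matrix ι ι 𝓐) :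
    (scalarMatrix 𝓐 X * Y).trace = (Y * scalarMatrix 𝓐 X).trace := by
  simp only [Matrix.trace, Matrix.diag_apply, Matrix.mul_apply, scalarMatrix, Matrix.map_apply]
  rw [Finset.sum_comm]
  exact Finset.sum_congr rfl fun i _ => Finset.sum_congr rfl fun j _ => Algebra.commutes _ _

end Scalar

section PartialTrace

theorem sum_rotate {α β γ M : Type*} [Fintype α] [Fintype β] [Fintype γ] [AddCommMonoid M]
    (F : α → β → γ → M) : ∑ a, ∑ b, ∑ c, F a b c = ∑ c, ∑ a, ∑ b, F a b c := by
  rw [Finset.sum_comm (s := Finset.univ (α := γ))]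
  exact Finset.sum_congr rfl fun a _ => Finset.sum_comm

variable {N n : ℕ} {𝓐 : Type} [Ring 𝓐]

theorem extend_mul_apply (X : Matrix (Fin n → Fin N) (Fin n → Fin N) 𝓐)
    (Y : Matrix (Fin (n + 1) → Fin N) (Fin (n + 1) → Fin N) 𝓐) (f : Fin n → Fin N)
    (a : Fin N) (g : Fin (n + 1) → Fin N) :
    (extend X * Y) (addLeg f a) g = ∑ h, X f h * Y (addLeg h a) g := by
  simp [Matrix.mul_apply, sum_addLeg]

theorem mul_extend_apply (X : Matrix (Fin n → Fin N) (Fin n → Fin N) 𝓐)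
    (Y : Matrix (Fin (n + 1) → Fin N) (Fin (n + 1) → Fin N) 𝓐) (f : Fin n → Fin N)
    (a : Fin N) (g : Fin (n + 1) → Fin N) :
    (Y * extend X) g (addLeg f a) = ∑ h, Y g (addLeg h a) * X h f := by
  simp [Matrix.mul_apply, sum_addLeg]

variable [Algebra ℂ 𝓐]

/-- The partial trace over the last tensor factor with the weight `C`. -/
def partialTrace (C : Matrix (Fin N) (Fin N) ℂ)
    (Y : Matrix (Fin (n + 1) → Fin N) (Fin (n + 1) → Fin N) 𝓐) :
    Matrix (Fin n → Fin N) (Fin n → Fin N) 𝓐 :=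
  Matrix.of fun f g => ∑ a, ∑ b, C a b • Y (addLeg f b) (addLeg g a)

theorem partialTrace_apply (C : Matrix (Fin N) (Fin N) ℂ)
    (Y : Matrix (Fin (n + 1) → Fin N) (Fin (n + 1) → Fin N) 𝓐) (f g : Fin n → Fin N) :
    partialTrace C Y f g = ∑ a, ∑ b, C a b • Y (addLeg f b) (addLeg g a) :=
  rfl

theorem partialTrace_extend_mul (C : Matrix (Fin N) (Fin N) ℂ)
    (X : Matrix (Fin n → Fin N) (Fin n → Fin N) 𝓐)
    (Y : Matrix (Fin (n + 1) → Fin N) (Fin (n + 1) → Fin N) 𝓐) :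
    partialTrace C (extend X * Y) = X * partialTrace C Y := by
  ext f g
  simp only [partialTrace_apply, extend_mul_apply]
  simp only [Matrix.mul_apply, partialTrace_apply, Finset.smul_sum, Finset.mul_sum,
    mul_smul_comm]
  exact sum_rotate _

theorem partialTrace_mul_extend (C : Matrix (Fin N) (Fin N) ℂ)
    (X : Matrix (Fin n → Fin N) (Fin n → Fin N) 𝓐)
    (Y : Matrix (Fin (n + 1) → Fin N) (Fin (n + 1) → Fin N) 𝓐) :
    partialTrace C (Y * extend X) = partialTrace C Y * X := by
  ext f g
  simp only [partialTrace_apply, mul_extend_apply]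
  simp only [Matrix.mul_apply, partialTrace_apply, Finset.smul_sum, Finset.sum_mul,
    smul_mul_assoc]
  exact sum_rotate _

theorem rTrace_eq_rTrace_partialTrace (Ψ : Matrix (Fin N × Fin N) (Fin N × Fin N) ℂ)
    (Y : Matrix (Fin (n + 1) → Fin N) (Fin (n + 1) → Fin N) 𝓐) :
    rTrace Ψ Y = rTrace Ψ (partialTrace (traceMatrix Ψ) Y) := by
  simp only [rTrace, Matrix.trace, Matrix.diag_apply, Matrix.mul_apply, scalarMatrix,
    Matrix.map_apply, Matrix.of_apply, sum_addLeg, partialTrace_apply, Fin.prod_univ_castSucc,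
    addLeg_last, addLeg_castSucc, Finset.smul_sum, ← Algebra.smul_def, mul_smul]
  exact Finset.sum_congr rfl fun f _ => Finset.sum_comm

end PartialTrace

/-! ### Braid matrices on the last two factors -/

section LastBraid

variable {N n : ℕ}

theorem braidLegs_injective {p : ℕ} (i : Fin p) :
    Function.Injective ![i.castSucc, i.succ] := by
  intro a b hab
  fin_cases a <;> fin_cases b <;> simp_all [Fin.ext_iff]

theorem braidMatrix_mul (S S' : Matrix (Fin N × Fin N) (Fin N × Fin N) ℂ) {p : ℕ} (i : Fin p) :
    braidMatrix S i * braidMatrix S' i = braidMatrix (S * S') i := by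
  rw [braidMatrix, braidMatrix, onLegs_mul (braidLegs_injective i), twoLegs_mul, braidMatrix]

theorem braidMatrix_one {p : ℕ} (i : Fin p) :
    braidMatrix (1 : Matrix (Fin N × Fin N) (Fin N × Fin N) ℂ) i = 1 := by
  rw [braidMatrix, twoLegs_one, onLegs_one]

theorem braidMatrix_sub_smul_one (S : Matrix (Fin N × Fin N) (Fin N × Fin N) ℂ) (c : ℂ) {p : ℕ}
    (i : Fin p) : braidMatrix (S - c • 1) i = braidMatrix S i - c • 1 := by
  have h : twoLegs (S - c • 1) = twoLegs S + (-c) • 1 := by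
    rw [← twoLegs_one]
    ext u v
    simp [twoLegs, sub_eq_add_neg]
  rw [braidMatrix, h, onLegs_add, onLegs_smul, onLegs_one, neg_smul, sub_eq_add_neg, braidMatrix]

/-- `onLegs` decides its condition classically; this replaces the condition by an equivalent one
with its own decidability instance. -/
theorem onLegs_apply_of_iff {κ J : Type} [Fintype J] [DecidableEq J] [Fintype κ] (s : κ → J)
    (M : Matrix (κ → Fin N) (κ → Fin N) ℂ) (f g : J → Fin N) (P : Prop) [Decidable P]
    (h : (∀ j, j ∉ Set.range s → f j = g j) ↔ P) :
    onLegs s M f g = if P then M (f ∘ s) (g ∘ s) else 0 := by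
  rw [onLegs, Matrix.of_apply]
  exact if_congr h rfl rfl

theorem extend_eq_onLegs (X : Matrix (Fin n → Fin N) (Fin n → Fin N) ℂ) :
    extend X = onLegs Fin.castSucc X := by
  refine matrix_ext_addLeg fun f a g b => ?_
  have h1 : addLeg f a ∘ Fin.castSucc = f := by ext; simp
  have h2 : addLeg g b ∘ Fin.castSucc = g := by ext; simp
  rw [extend_apply, onLegs_apply_of_iff Fin.castSucc X _ _ (a = b), h1, h2]
  refine ⟨fun h => ?_, fun h j hj => ?_⟩
  · simpa using h (Fin.last n) (by simp)
  · rcases Fin.eq_castSucc_or_eq_last j with ⟨i, rfl⟩ | rfl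
    · exact absurd ⟨i, rfl⟩ hj
    · simpa using h

theorem braidMatrix_castSucc (S : Matrix (Fin N × Fin N) (Fin N × Fin N) ℂ) {p : ℕ} (i : Fin p) :
    braidMatrix S i.castSucc = extend (braidMatrix S i) := by
  rw [extend_eq_onLegs, braidMatrix, braidMatrix, onLegs_onLegs (Fin.castSucc_injective _)]
  congr 1
  funext a
  fin_cases a <;> rfl

theorem braidMatrix_last_apply (S : Matrix (Fin N × Fin N) (Fin N × Fin N) ℂ)
    (f g : Fin n → Fin N) (a b c d : Fin N) :
    braidMatrix S (Fin.last n) (addLeg (addLeg f a) b) (addLeg (addLeg g c) d) =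
      if f = g then S (a, b) (c, d) else 0 := by
  rw [braidMatrix, onLegs_apply_of_iff _ _ _ _ (f = g)]
  · simp [twoLegs]
  refine ⟨fun h => funext fun j => ?_, ?_⟩
  · have := h j.castSucc.castSucc ?_
    · simpa using this
    · rintro ⟨i, hi⟩
      have h1 := j.2
      fin_cases i <;> simp [Fin.ext_iff] at hi <;> omega
  · rintro rfl j hj
    rcases Fin.eq_castSucc_or_eq_last j with ⟨i, rfl⟩ | rfl
    · rcases Fin.eq_castSucc_or_eq_last i with ⟨i, rfl⟩ | rfl
      · simp
      · exact absurd ⟨0, rfl⟩ hj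
    · exact absurd ⟨1, rfl⟩ hj

variable {𝓐 : Type} [Ring 𝓐] [Algebra ℂ 𝓐]

theorem scalar_braidMatrix_last_mul_apply (S : Matrix (Fin N × Fin N) (Fin N × Fin N) ℂ)
    (Y : Matrix (Fin (n + 2) → Fin N) (Fin (n + 2) → Fin N) 𝓐)
    (f : Fin n → Fin N) (a b : Fin N) (g : Fin (n + 2) → Fin N) :
    (scalarMatrix 𝓐 (braidMatrix S (Fin.last n)) * Y) (addLeg (addLeg f a) b) g =
      ∑ x, ∑ y, S (a, b) (x, y) • Y (addLeg (addLeg f x) y) g := by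
  simp only [Matrix.mul_apply, sum_addLeg, scalarMatrix, Matrix.map_apply,
    braidMatrix_last_apply]
  rw [Finset.sum_eq_single f]
  · simp [Algebra.smul_def]
  · intro h _ hh
    simp [hh.symm]
  · simp

theorem mul_scalar_braidMatrix_last_apply (S : Matrix (Fin N × Fin N) (Fin N × Fin N) ℂ)
    (Y : Matrix (Fin (n + 2) → Fin N) (Fin (n + 2) → Fin N) 𝓐)
    (f : Fin n → Fin N) (a b : Fin N) (g : Fin (n + 2) → Fin N) :
    (Y * scalarMatrix 𝓐 (braidMatrix S (Fin.last n))) g (addLeg (addLeg f a) b) =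
      ∑ x, ∑ y, S (x, y) (a, b) • Y g (addLeg (addLeg f x) y) := by
  simp only [Matrix.mul_apply, sum_addLeg, scalarMatrix, Matrix.map_apply,
    braidMatrix_last_apply]
  rw [Finset.sum_eq_single f]
  · simp [Algebra.smul_def, Algebra.commutes]
  · intro h _ hh
    simp [hh]
  · simp

theorem scalar_braidMatrix_last_comm (S : Matrix (Fin N × Fin N) (Fin N × Fin N) ℂ)
    (X : Matrix (Fin n → Fin N) (Fin n → Fin N) 𝓐) :
    scalarMatrix 𝓐 (braidMatrix S (Fin.last n)) * extend (extend X) =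
      extend (extend X) * scalarMatrix 𝓐 (braidMatrix S (Fin.last n)) := by
  refine matrix_ext_addLeg fun f b g d => ?_
  obtain ⟨f, a, rfl⟩ := exists_eq_addLeg f
  obtain ⟨g, c, rfl⟩ := exists_eq_addLeg g
  rw [scalar_braidMatrix_last_mul_apply, mul_scalar_braidMatrix_last_apply]
  simp

theorem partialTrace_scalarMatrix (C : Matrix (Fin N) (Fin N) ℂ)
    (X : Matrix (Fin (n + 1) → Fin N) (Fin (n + 1) → Fin N) ℂ) :
    partialTrace C (scalarMatrix 𝓐 X) = scalarMatrix 𝓐 (partialTrace C X) := by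
  ext f g
  simp [partialTrace_apply, scalarMatrix, Algebra.smul_def]

/-- The coefficients in front of the entries of `X` are complex numbers depending only on `C`, `S`
and `S'`. Trace identities over any algebra thus reduce to identities between complex numbers. -/
theorem partialTrace_conj_extend (C : Matrix (Fin N) (Fin N) ℂ)
    (S S' : Matrix (Fin N × Fin N) (Fin N × Fin N) ℂ)
    (X : Matrix (Fin (n + 1) → Fin N) (Fin (n + 1) → Fin N) 𝓐) (f g : Fin n → Fin N)
    (a c : Fin N) :
    partialTrace C (scalarMatrix 𝓐 (braidMatrix S (Fin.last n)) * extend X *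
      scalarMatrix 𝓐 (braidMatrix S' (Fin.last n))) (addLeg f a) (addLeg g c) =
      ∑ x, ∑ z, (∑ d, ∑ b, ∑ y, C d b * S (a, b) (x, y) * S' (z, y) (c, d)) •
        X (addLeg f x) (addLeg g z) := by
  rw [partialTrace_apply]
  simp only [mul_scalar_braidMatrix_last_apply]
  simp only [scalar_braidMatrix_last_mul_apply, extend_apply]
  simp only [Finset.smul_sum, smul_ite, smul_zero, Finset.sum_ite_eq',
    Finset.mem_univ, if_true, Finset.sum_smul, smul_smul]
  refine (Finset.sum_congr rfl fun d _ => Finset.sum_congr rfl fun b _ => sum_rotate _).trans ?_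
  refine (sum_rotate _).trans (Finset.sum_congr rfl fun x _ => ?_)
  refine (sum_rotate _).trans (Finset.sum_congr rfl fun z _ => ?_)
  refine Finset.sum_congr rfl fun d _ => Finset.sum_congr rfl fun b _ =>
    Finset.sum_congr rfl fun y _ => ?_
  congr 1
  ring

end LastBraid

/-! ### The weight C and the skew inverse. -/

section SkewInverse

variable {N : ℕ} {R Ψ : Matrix (Fin N × Fin N) (Fin N × Fin N) ℂ}

/-- This is Tr₂(C₂R₁₂) = I: since C is a partial trace of `Ψ`, it follows by setting `k = l` in the
first skew-inverse identity and summing over it. -/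
theorem IsSkewInverse.sum_traceMatrix (hΨ : IsSkewInverse R Ψ) (a c : Fin N) :
    ∑ d, ∑ b, traceMatrix Ψ d b * R (a, b) (c, d) = if a = c then 1 else 0 := by
  have h : ∀ x, ∑ b, ∑ d, R (a, b) (c, d) * Ψ (d, x) (b, x) = if a = x ∧ x = c then 1 else 0 :=
    fun x => hΨ.left a c x x
  have h2 := Finset.sum_congr rfl fun x (_ : x ∈ Finset.univ) => h x
  have h3 : (∑ x, if a = x ∧ x = c then (1 : ℂ) else 0) = if a = c then 1 else 0 := by
    simp [ite_and]
  rw [← h3, ← h2]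
  simp only [traceMatrix, Matrix.of_apply, Finset.sum_mul]
  rw [sum_rotate]
  refine Finset.sum_congr rfl fun x _ => ?_
  rw [Finset.sum_comm]
  simp only [mul_comm]

theorem IsSkewInverse.partialTrace_braidMatrix (hΨ : IsSkewInverse R Ψ) (n : ℕ) :
    partialTrace (traceMatrix Ψ) (braidMatrix R (Fin.last n)) = 1 := by
  refine matrix_ext_addLeg fun f a g c => ?_
  simp only [partialTrace_apply, braidMatrix_last_apply, smul_eq_mul, mul_ite, mul_zero,
    Matrix.one_apply, addLeg_inj]
  by_cases h : f = g
  · simp [h, hΨ.sum_traceMatrix]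
  · simp [h]

/-- The conclusion is Tr₂(C₂S₁₂X₁S'₁₂) = Tr(CX)·I for every `X`, in coefficients. It suffices to
know it with `R₁₂` in place of `X`: skew-invertibility says that the blocks of `R` span all
matrices, and `Ψ` gives the expansion of a matrix unit in them. -/
theorem IsSkewInverse.sum_conj (hΨ : IsSkewInverse R Ψ)
    {S S' : Matrix (Fin N × Fin N) (Fin N × Fin N) ℂ}
    (h : partialTrace (traceMatrix Ψ) (braidMatrix S (Fin.last 1) *
      extend (braidMatrix R (Fin.last 0)) * braidMatrix S' (Fin.last 1)) = 1)
    (a c x z : Fin N) :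
    ∑ d, ∑ b, ∑ y, traceMatrix Ψ d b * S (a, b) (x, y) * S' (z, y) (c, d) =
      if a = c then traceMatrix Ψ z x else 0 := by
  set K : Fin N → Fin N → ℂ := fun x z => ∑ d, ∑ b, ∑ y,
    traceMatrix Ψ d b * S (a, b) (x, y) * S' (z, y) (c, d) with hK
  have h1 : ∀ f g, ∑ x, ∑ z, K x z * R (f, x) (g, z) = if f = g ∧ a = c then 1 else 0 := by
    intro f g
    have h2 := congrFun (congrFun h (addLeg (addLeg Fin.elim0 f) a))
      (addLeg (addLeg Fin.elim0 g) c)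
    rw [← scalarMatrix_complex (braidMatrix S _), ← scalarMatrix_complex (braidMatrix S' _),
      partialTrace_conj_extend] at h2
    simp only [braidMatrix_last_apply, smul_eq_mul, if_true] at h2
    simpa [Matrix.one_apply, addLeg_inj] using h2
  -- Contraction with `Ψ` undoes the pairing with `R` and isolates one coefficient `K x z`.
  have h3 : ∑ f, ∑ g, Ψ (z, g) (x, f) * ∑ x', ∑ z', K x' z' * R (f, x') (g, z') = K x z := by
    simp only [Finset.mul_sum]
    have h4 : ∀ x' z', ∑ f, ∑ g, Ψ (z, g) (x, f) * (K x' z' * R (f, x') (g, z')) =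
        if x' = x ∧ z' = z then K x' z' else 0 := by
      intro x' z'
      have h5 := hΨ.right z x x' z'
      rw [Finset.sum_comm] at h5
      have h6 : ∀ f g, Ψ (z, g) (x, f) * (K x' z' * R (f, x') (g, z')) =
          K x' z' * (Ψ (z, g) (x, f) * R (f, x') (g, z')) := fun f g => by ring
      simp only [h6, ← Finset.mul_sum, h5]
      rw [mul_ite, mul_one, mul_zero]
      exact if_congr (by tauto) rfl rfl
    refine (sum_rotate _).trans ?_
    refine (Finset.sum_congr rfl fun x' _ => sum_rotate _).trans ?_
    simp only [h4]
    simp [ite_and]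
  change K x z = _
  rw [← h3]
  simp only [h1]
  by_cases hac : a = c
  · simp [hac, traceMatrix]
  · simp [hac]

end SkewInverse

/-! ### The R-trace of a Hecke symmetry -/

section HeckeTrace

variable {N : ℕ} {q : ℂ} {R Ψ : Matrix (Fin N × Fin N) (Fin N × Fin N) ℂ}

/-- The Hecke relation makes x - ω the inverse of x. So R⁻¹ is itself the matrix `R - (q - q⁻¹) •
1`, and the results on braid matrices of arbitrary `S` apply to it. -/
theorem mul_sub_smul_one_of_hecke {A : Type*} [Ring A] [Algebra ℂ A] (hq0 : q ≠ 0) {x : A}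
    (h : (q • 1 - x) * (q⁻¹ • 1 + x) = 0) : x * (x - (q - q⁻¹) • 1) = 1 := by
  have h1 : (q • 1 - x) * (q⁻¹ • 1 + x) = 1 - x * (x - (q - q⁻¹) • 1) := by
    simp only [sub_mul, mul_add, mul_sub, smul_mul_assoc, mul_smul_comm, one_mul, mul_one,
      sub_smul, smul_sub, smul_smul, inv_mul_cancel₀ hq0, one_smul]
    abel
  rw [h1] at h
  exact (sub_eq_zero.mp h).symm

theorem sub_smul_one_mul_of_hecke {A : Type*} [Ring A] [Algebra ℂ A] (hq0 : q ≠ 0) {x : A}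
    (h : (q • 1 - x) * (q⁻¹ • 1 + x) = 0) : (x - (q - q⁻¹) • 1) * x = 1 := by
  refine Eq.trans ?_ (mul_sub_smul_one_of_hecke hq0 h)
  simp only [sub_mul, mul_sub, smul_mul_assoc, mul_smul_comm, one_mul, mul_one]

theorem braidMatrix_mul_inverse (hR : IsHeckeSymmetry q R) (hq0 : q ≠ 0) {p : ℕ} (i : Fin p) :
    braidMatrix R i * braidMatrix (R - (q - q⁻¹) • 1) i = 1 := by
  rw [braidMatrix_mul, mul_sub_smul_one_of_hecke hq0 hR.hecke, braidMatrix_one]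

theorem inverse_mul_braidMatrix (hR : IsHeckeSymmetry q R) (hq0 : q ≠ 0) {p : ℕ} (i : Fin p) :
    braidMatrix (R - (q - q⁻¹) • 1) i * braidMatrix R i = 1 := by
  rw [braidMatrix_mul, sub_smul_one_mul_of_hecke hq0 hR.hecke, braidMatrix_one]

theorem braidMatrix_inv (hR : IsHeckeSymmetry q R) (hq0 : q ≠ 0) {p : ℕ} (i : Fin p) :
    (braidMatrix R i)⁻¹ = braidMatrix (R - (q - q⁻¹) • 1) i :=
  Matrix.inv_eq_right_inv (braidMatrix_mul_inverse hR hq0 i)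

theorem IsHeckeSymmetry.sum_conj (hR : IsHeckeSymmetry q R) (hq0 : q ≠ 0)
    (hΨ : IsSkewInverse R Ψ) (a c x z : Fin N) :
    ∑ d, ∑ b, ∑ y, traceMatrix Ψ d b * R (a, b) (x, y) *
      (R - (q - q⁻¹) • 1) (z, y) (c, d) = if a = c then traceMatrix Ψ z x else 0 := by
  refine hΨ.sum_conj ?_ a c x z
  have e : extend (braidMatrix R (Fin.last 0)) = braidMatrix R (0 : Fin 2) :=
    (braidMatrix_castSucc R (Fin.last 0)).symm
  have e' : extend (braidMatrix (R - (q - q⁻¹) • 1) (Fin.last 0)) =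
    braidMatrix (R - (q - q⁻¹) • 1) (0 : Fin 2) := (braidMatrix_castSucc _ (Fin.last 0)).symm
  -- The braid relation as R₂R₁R₂⁻¹ = R₁⁻¹R₂R₁: the right side has a single matrix touching the
  -- third factor, so its partial trace is R₁⁻¹·1·R₁ = 1.
  have h : braidMatrix R (Fin.last 1) * braidMatrix R (0 : Fin 2) *
      braidMatrix (R - (q - q⁻¹) • 1) (Fin.last 1) =
      braidMatrix (R - (q - q⁻¹) • 1) (0 : Fin 2) * (braidMatrix R (Fin.last 1) *
        braidMatrix R (0 : Fin 2)) := by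
    have hb : braidMatrix R (0 : Fin 2) * (braidMatrix R (Fin.last 1) * braidMatrix R (0 : Fin 2)) =
        braidMatrix R (Fin.last 1) * braidMatrix R (0 : Fin 2) * braidMatrix R (Fin.last 1) := by
      rw [← mul_assoc]; exact hR.braid
    have h1 := inverse_mul_braidMatrix hR hq0 (0 : Fin 2)
    have h2 := braidMatrix_mul_inverse hR hq0 (Fin.last 1)
    generalize braidMatrix R (0 : Fin 2) = r at *
    generalize braidMatrix R (Fin.last 1) = s at *
    generalize braidMatrix (R - (q - q⁻¹) • 1) (0 : Fin 2) = r' at *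
    generalize braidMatrix (R - (q - q⁻¹) • 1) (Fin.last 1) = s' at *
    calc s * r * s' = r' * r * (s * r * s') := by rw [h1, one_mul]
      _ = r' * (r * (s * r)) * s' := by simp only [mul_assoc]
      _ = r' * (s * r) * (s * s') := by rw [hb]; simp only [mul_assoc]
      _ = r' * (s * r) := by rw [h2, mul_one]
  rw [e, h, ← e, ← e', partialTrace_extend_mul, partialTrace_mul_extend,
    hΨ.partialTrace_braidMatrix, one_mul, inverse_mul_braidMatrix hR hq0]

theorem IsHeckeSymmetry.sum_conj_inverse (hR : IsHeckeSymmetry q R) (hq0 : q ≠ 0)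
    (hΨ : IsSkewInverse R Ψ) (a c x z : Fin N) :
    ∑ d, ∑ b, ∑ y, traceMatrix Ψ d b * (R - (q - q⁻¹) • 1) (a, b) (x, y) *
      R (z, y) (c, d) = if a = c then traceMatrix Ψ z x else 0 := by
  refine hΨ.sum_conj ?_ a c x z
  have e : extend (braidMatrix R (Fin.last 0)) = braidMatrix R (0 : Fin 2) :=
    (braidMatrix_castSucc R (Fin.last 0)).symm
  have e' : extend (braidMatrix (R - (q - q⁻¹) • 1) (Fin.last 0)) =
    braidMatrix (R - (q - q⁻¹) • 1) (0 : Fin 2) := (braidMatrix_castSucc _ (Fin.last 0)).symm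
  have h : braidMatrix (R - (q - q⁻¹) • 1) (Fin.last 1) * braidMatrix R (0 : Fin 2) *
      braidMatrix R (Fin.last 1) =
      braidMatrix R (0 : Fin 2) * (braidMatrix R (Fin.last 1) *
        braidMatrix (R - (q - q⁻¹) • 1) (0 : Fin 2)) := by
    have hb : braidMatrix R (0 : Fin 2) * (braidMatrix R (Fin.last 1) * braidMatrix R (0 : Fin 2)) =
        braidMatrix R (Fin.last 1) * braidMatrix R (0 : Fin 2) * braidMatrix R (Fin.last 1) := by
      rw [← mul_assoc]; exact hR.braid
    have h1 := braidMatrix_mul_inverse hR hq0 (0 : Fin 2)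
    have h2 := inverse_mul_braidMatrix hR hq0 (Fin.last 1)
    generalize braidMatrix R (0 : Fin 2) = r at *
    generalize braidMatrix R (Fin.last 1) = s at *
    generalize braidMatrix (R - (q - q⁻¹) • 1) (0 : Fin 2) = r' at *
    generalize braidMatrix (R - (q - q⁻¹) • 1) (Fin.last 1) = s' at *
    calc s' * r * s = s' * r * s * (r * r') := by rw [h1, mul_one]
      _ = s' * (r * (s * r)) * r' := by simp only [mul_assoc]
      _ = s' * s * (r * (s * r')) := by rw [hb]; simp only [mul_assoc]
      _ = r * (s * r') := by rw [h2, one_mul]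
  rw [e, h, ← e, ← e', partialTrace_extend_mul, partialTrace_mul_extend,
    hΨ.partialTrace_braidMatrix, one_mul, braidMatrix_mul_inverse hR hq0]

theorem IsHeckeSymmetry.partialTrace_conj {𝓐 : Type} [Ring 𝓐] [Algebra ℂ 𝓐]
    (hR : IsHeckeSymmetry q R) (hq0 : q ≠ 0) (hΨ : IsSkewInverse R Ψ) {n : ℕ}
    (X : Matrix (Fin (n + 1) → Fin N) (Fin (n + 1) → Fin N) 𝓐) :
    partialTrace (traceMatrix Ψ) (scalarMatrix 𝓐 (braidMatrix R (Fin.last n)) * extend X *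
      scalarMatrix 𝓐 (braidMatrix R (Fin.last n))⁻¹) =
      extend (partialTrace (traceMatrix Ψ) X) := by
  rw [braidMatrix_inv hR hq0]
  refine matrix_ext_addLeg fun f a g c => ?_
  rw [partialTrace_conj_extend]
  simp only [hR.sum_conj hq0 hΨ, extend_apply, partialTrace_apply]
  rw [Finset.sum_comm]
  split_ifs <;> simp

/-- Contracting the conjugation formula `sum_conj` with `Ψ` cancels the factor `R` and leaves R⁻¹
multiplied by C on one leg. -/
theorem IsHeckeSymmetry.sum_inverse_mul_traceMatrix (hR : IsHeckeSymmetry q R) (hq0 : q ≠ 0)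
    (hΨ : IsSkewInverse R Ψ) (z i c j : Fin N) :
    ∑ d, (R - (q - q⁻¹) • 1) (z, i) (c, d) * traceMatrix Ψ d j =
      ∑ x, traceMatrix Ψ z x * Ψ (i, x) (j, c) := by
  set S := R - (q - q⁻¹) • (1 : Matrix (Fin N × Fin N) (Fin N × Fin N) ℂ) with hS
  have h1 : ∑ a, ∑ x, Ψ (i, x) (j, a) * ∑ d, ∑ b, ∑ y, traceMatrix Ψ d b * R (a, b) (x, y) *
      S (z, y) (c, d) = ∑ x, traceMatrix Ψ z x * Ψ (i, x) (j, c) := by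
    simp only [hS, hR.sum_conj hq0 hΨ]
    rw [Finset.sum_comm]
    refine Finset.sum_congr rfl fun x _ => ?_
    simp [mul_comm]
  rw [← h1]
  have h2 : ∀ d b y, ∑ a, ∑ x, Ψ (i, x) (j, a) * (traceMatrix Ψ d b * R (a, b) (x, y) *
      S (z, y) (c, d)) = if i = y ∧ b = j then traceMatrix Ψ d b * S (z, y) (c, d) else 0 := by
    intro d b y
    have h3 := hΨ.right i j b y
    rw [Finset.sum_comm] at h3
    have h4 : ∀ a x, Ψ (i, x) (j, a) * (traceMatrix Ψ d b * R (a, b) (x, y) * S (z, y) (c, d)) =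
      traceMatrix Ψ d b * S (z, y) (c, d) * (Ψ (i, x) (j, a) * R (a, b) (x, y)) :=
      fun a x => by ring
    simp only [h4, ← Finset.mul_sum, h3]
    rw [mul_ite, mul_one, mul_zero]
  simp only [Finset.mul_sum]
  refine Eq.symm ((sum_rotate _).trans (Finset.sum_congr rfl fun d _ => ?_))
  refine (sum_rotate _).trans ?_
  refine (Finset.sum_congr rfl fun b _ => sum_rotate _).trans ?_
  simp only [h2]
  simp [ite_and, mul_comm]

theorem IsHeckeSymmetry.sum_traceMatrix_mul_inverse (hR : IsHeckeSymmetry q R) (hq0 : q ≠ 0)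
    (hΨ : IsSkewInverse R Ψ) (i a x j : Fin N) :
    ∑ b, traceMatrix Ψ i b * (R - (q - q⁻¹) • 1) (a, b) (x, j) =
      ∑ z, Ψ (i, a) (j, z) * traceMatrix Ψ z x := by
  set S := R - (q - q⁻¹) • (1 : Matrix (Fin N × Fin N) (Fin N × Fin N) ℂ) with hS
  have h1 : ∑ z, ∑ c, Ψ (i, c) (j, z) * ∑ d, ∑ b, ∑ y, traceMatrix Ψ d b * S (a, b) (x, y) *
      R (z, y) (c, d) = ∑ z, Ψ (i, a) (j, z) * traceMatrix Ψ z x := by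
    simp only [hS, hR.sum_conj_inverse hq0 hΨ]
    simp
  rw [← h1]
  have h2 : ∀ d b y, ∑ z, ∑ c, Ψ (i, c) (j, z) * (traceMatrix Ψ d b * S (a, b) (x, y) *
      R (z, y) (c, d)) = if i = d ∧ y = j then traceMatrix Ψ d b * S (a, b) (x, y) else 0 := by
    intro d b y
    have h3 := hΨ.right i j y d
    rw [Finset.sum_comm] at h3
    have h4 : ∀ z c, Ψ (i, c) (j, z) * (traceMatrix Ψ d b * S (a, b) (x, y) * R (z, y) (c, d)) =
      traceMatrix Ψ d b * S (a, b) (x, y) * (Ψ (i, c) (j, z) * R (z, y) (c, d)) :=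
      fun z c => by ring
    simp only [h4, ← Finset.mul_sum, h3]
    rw [mul_ite, mul_one, mul_zero]
  simp only [Finset.mul_sum]
  refine Eq.symm ((sum_rotate _).trans ?_)
  refine (Finset.sum_congr rfl fun d _ => (sum_rotate _).trans
    (Finset.sum_congr rfl fun b _ => sum_rotate _)).trans ?_
  simp only [h2]
  rw [Finset.sum_comm]
  simp [ite_and]

/-- Both sides equal the same expression, `Ψ` with a C on either side: the two preceding formulas
each trade R⁻¹ and one C for `Ψ` and the other C. -/
theorem IsHeckeSymmetry.inverse_comm_traceMatrix (hR : IsHeckeSymmetry q R) (hq0 : q ≠ 0)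
    (hΨ : IsSkewInverse R Ψ) (a b c d : Fin N) :
    ∑ x, ∑ y, (R - (q - q⁻¹) • 1) (a, b) (x, y) * (traceMatrix Ψ x c * traceMatrix Ψ y d) =
      ∑ x, ∑ y, (traceMatrix Ψ a x * traceMatrix Ψ b y) * (R - (q - q⁻¹) • 1) (x, y) (c, d) := by
  have h1 := fun x => hR.sum_inverse_mul_traceMatrix hq0 hΨ a b x d
  have h2 := fun x => hR.sum_traceMatrix_mul_inverse hq0 hΨ b x c d
  calc _ = ∑ x, (∑ y, (R - (q - q⁻¹) • 1) (a, b) (x, y) * traceMatrix Ψ y d) *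
          traceMatrix Ψ x c := by
        simp only [Finset.sum_mul]
        exact Finset.sum_congr rfl fun x _ => Finset.sum_congr rfl fun y _ => by ring
    _ = ∑ x, traceMatrix Ψ a x * ∑ z, Ψ (b, x) (d, z) * traceMatrix Ψ z c := by
        simp only [h1, Finset.sum_mul, Finset.mul_sum]
        rw [Finset.sum_comm]
        exact Finset.sum_congr rfl fun x _ => Finset.sum_congr rfl fun y _ => by ring
    _ = _ := by
        simp only [← h2, Finset.mul_sum]
        exact Finset.sum_congr rfl fun x _ => Finset.sum_congr rfl fun y _ => by ring

/-- The matrix `C ⊗ ⋯ ⊗ C`. -/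
def tensorPower (C : Matrix (Fin N) (Fin N) ℂ) (n : ℕ) :
    Matrix (Fin n → Fin N) (Fin n → Fin N) ℂ :=
  Matrix.of fun f g => ∏ a, C (f a) (g a)

theorem tensorPower_addLeg (C : Matrix (Fin N) (Fin N) ℂ) {n : ℕ} (f g : Fin n → Fin N)
    (a b : Fin N) :
    tensorPower C (n + 1) (addLeg f a) (addLeg g b) = tensorPower C n f g * C a b := by
  simp [tensorPower, Fin.prod_univ_castSucc]

theorem extend_comm_tensorPower {n : ℕ} (C : Matrix (Fin N) (Fin N) ℂ)
    {X : Matrix (Fin n → Fin N) (Fin n → Fin N) ℂ} (h : Commute X (tensorPower C n)) :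
    Commute (extend X) (tensorPower C (n + 1)) := by
  refine matrix_ext_addLeg fun f a g b => ?_
  have h1 := congrFun (congrFun h.eq f) g
  simp only [Matrix.mul_apply] at h1
  simp only [extend_mul_apply, mul_extend_apply, tensorPower_addLeg]
  simp only [← mul_assoc, ← Finset.sum_mul, h1]
  rw [Finset.sum_mul]
  exact Finset.sum_congr rfl fun x _ => by ring

theorem IsHeckeSymmetry.commute_tensorPower (hR : IsHeckeSymmetry q R) (hq0 : q ≠ 0)
    (hΨ : IsSkewInverse R Ψ) {p : ℕ} (i : Fin p) :
    Commute (braidMatrix R i) (tensorPower (traceMatrix Ψ) (p + 1)) := by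
  induction p with
  | zero => exact i.elim0
  | succ p ih =>
    rcases Fin.eq_castSucc_or_eq_last i with ⟨i, rfl⟩ | rfl
    · rw [braidMatrix_castSucc]
      exact extend_comm_tensorPower _ (ih i)
    · have h : Commute (braidMatrix (R - (q - q⁻¹) • 1) (Fin.last p))
          (tensorPower (traceMatrix Ψ) (p + 2)) := by
        refine matrix_ext_addLeg fun f b g d => ?_
        obtain ⟨f, a, rfl⟩ := exists_eq_addLeg f
        obtain ⟨g, c, rfl⟩ := exists_eq_addLeg g
        rw [← scalarMatrix_complex (braidMatrix _ _), scalar_braidMatrix_last_mul_apply,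
          mul_scalar_braidMatrix_last_apply]
        simp only [tensorPower_addLeg, smul_eq_mul]
        have h1 := congrArg (tensorPower (traceMatrix Ψ) p f g * ·)
          (hR.inverse_comm_traceMatrix hq0 hΨ a b c d)
        simp only [Finset.mul_sum] at h1
        refine Eq.trans ?_ (h1.trans ?_) <;>
        exact Finset.sum_congr rfl fun x _ => Finset.sum_congr rfl fun y _ => by ring
      -- The commutation is known for R⁻¹ = R - ω; adding back ω·1 gives it for R.
      rw [braidMatrix_sub_smul_one] at h
      have h2 := h.add_left (((Commute.one_left _).smul_left (q - q⁻¹)))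
      rwa [sub_add_cancel] at h2

/-- This is the only cyclicity available for the R-trace: the matrix moved around must have complex
entries and commute with the weight. -/
theorem rTrace_scalar_mul_comm {𝓐 : Type} [Ring 𝓐] [Algebra ℂ 𝓐] {n : ℕ}
    {X : Matrix (Fin n → Fin N) (Fin n → Fin N) ℂ}
    (h : Commute X (tensorPower (traceMatrix Ψ) n))
    (Y : Matrix (Fin n → Fin N) (Fin n → Fin N) 𝓐) :
    rTrace Ψ (scalarMatrix 𝓐 X * Y) = rTrace Ψ (Y * scalarMatrix 𝓐 X) := by
  change (scalarMatrix 𝓐 (tensorPower _ n) * _).trace =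
    (scalarMatrix 𝓐 (tensorPower _ n) * _).trace
  rw [← mul_assoc, ← scalarMatrix_mul, ← h.eq, scalarMatrix_mul, mul_assoc,
    trace_scalarMatrix_mul_comm, mul_assoc]

end HeckeTrace

/-! ### The copies of the generating matrix -/

section BraidAlgebra

variable {A : Type*} [Monoid A] {r s r' s' l : A}

/-- With `r = R_k`, `s = R_{k+1}`, `l = L_k`, the conjugated element is `L_{k+2}`. The braid
relation turns `r` into `s` on its way in, `s` passes `l`, and the braid relation turns it back into
`r` on the way out. -/
theorem commute_conj_conj_of_braid (hb : r * s * r = s * r * s) (hr : r * r' = 1)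
    (hr' : r' * r = 1) (hs : s * s' = 1) (hs' : s' * s = 1) (hl : s * l = l * s) :
    Commute r (s * (r * l * r') * s') := by
  have h1 : r * s * r' = s' * r * s := by
    calc r * s * r' = s' * s * (r * s * r') := by rw [hs', one_mul]
      _ = s' * (s * r * s) * r' := by simp only [mul_assoc]
      _ = s' * r * s * (r * r') := by rw [← hb]; simp only [mul_assoc]
      _ = s' * r * s := by rw [hr, mul_one]
  have h2 : s * r' * s' = r' * s' * r := by
    calc s * r' * s' = r' * r * (s * r' * s') := by rw [hr', one_mul]
      _ = r' * (r * s * r') * s' := by simp only [mul_assoc]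
      _ = r' * s' * r * (s * s') := by rw [h1]; simp only [mul_assoc]
      _ = r' * s' * r := by rw [hs, mul_one]
  calc r * (s * (r * l * r') * s') = (r * s * r) * l * r' * s' := by simp only [mul_assoc]
    _ = s * r * (s * l) * r' * s' := by rw [hb]; simp only [mul_assoc]
    _ = s * r * l * (s * r' * s') := by rw [hl]; simp only [mul_assoc]
    _ = s * (r * l * r') * s' * r := by rw [h2]; simp only [mul_assoc]

/-- Conjugation by `r * s` sends `r` to `s` and `l` to `r * l * r'`, so it carries the reflection
equation for `(r, l)` to the one for `(s, r * l * r')`. -/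
theorem reflection_conj_of_braid (hb : r * s * r = s * r * s) (hr : r * r' = 1)
    (hr' : r' * r = 1) (hs : s * s' = 1) (hs' : s' * s = 1) (hl : s * l = l * s)
    (h : r * l * r * l = l * r * l * r) :
    s * (r * l * r') * s * (r * l * r') = (r * l * r') * s * (r * l * r') * s := by
  have h1 : r' * s * r = s * r * s' := by
    calc r' * s * r = r' * (s * r * s) * s' := by simp only [mul_assoc, hs, mul_one]
      _ = r' * r * (s * r * s') := by rw [← hb]; simp only [mul_assoc]
      _ = s * r * s' := by rw [hr', one_mul]
  have hl' : s' * l = l * s' := by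
    calc s' * l = s' * (l * s) * s' := by simp only [mul_assoc, hs, mul_one]
      _ = s' * s * l * s' := by rw [← hl]; simp only [mul_assoc]
      _ = l * s' := by rw [hs', one_mul]
  have h2 : s' * r' * s = r * s' * r' := by
    calc s' * r' * s = s' * (r' * s * r) * r' := by simp only [mul_assoc, hr, mul_one]
      _ = s' * s * (r * s' * r') := by rw [h1]; simp only [mul_assoc]
      _ = r * s' * r' := by rw [hs', one_mul]
  have hL : s * (r * l * r') * s * (r * l * r') = r * s * (l * r * l * r) * s' * r' := by
    calc s * (r * l * r') * s * (r * l * r') = s * r * l * (r' * s * r) * l * r' := by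
          simp only [mul_assoc]
      _ = s * r * (l * s) * r * (s' * l) * r' := by rw [h1]; simp only [mul_assoc]
      _ = (s * r * s) * l * r * l * s' * r' := by rw [← hl, hl']; simp only [mul_assoc]
      _ = r * s * (r * l * r * l) * s' * r' := by rw [← hb]; simp only [mul_assoc]
      _ = _ := by rw [h]
  have hR : (r * l * r') * s * (r * l * r') * s = r * s * (l * r * l * r) * s' * r' := by
    calc (r * l * r') * s * (r * l * r') * s = r * l * (r' * s * r) * l * r' * s := by
          simp only [mul_assoc]
      _ = r * (l * s) * r * (s' * l) * r' * s := by rw [h1]; simp only [mul_assoc]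
      _ = r * s * l * r * l * (s' * r' * s) := by rw [← hl, hl']; simp only [mul_assoc]
      _ = _ := by rw [h2]; simp only [mul_assoc]
  rw [hL, hR]

end BraidAlgebra

section Copies

variable {N : ℕ} {q : ℂ} {R Ψ : Matrix (Fin N × Fin N) (Fin N × Fin N) ℂ}

/-- The matrix `R_{i+1}` with entries in the reflection equation algebra. -/
noncomputable def reBraid (R : Matrix (Fin N × Fin N) (Fin N × Fin N) ℂ) {p : ℕ} (i : Fin p) :
    Matrix (Fin (p + 1) → Fin N) (Fin (p + 1) → Fin N) (REAlgebra R) :=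
  scalarMatrix (REAlgebra R) (braidMatrix R i)

/-- The inverse of `R_{i+1}` with entries in the reflection equation algebra. -/
noncomputable def reBraidInv (R : Matrix (Fin N × Fin N) (Fin N × Fin N) ℂ) {p : ℕ}
    (i : Fin p) : Matrix (Fin (p + 1) → Fin N) (Fin (p + 1) → Fin N) (REAlgebra R) :=
  scalarMatrix (REAlgebra R) (braidMatrix R i)⁻¹

theorem reBraid_mul_inv (hR : IsHeckeSymmetry q R) (hq0 : q ≠ 0) {p : ℕ} (i : Fin p) :
    reBraid R i * reBraidInv R i = 1 := by
  rw [reBraid, reBraidInv, ← scalarMatrix_mul, braidMatrix_inv hR hq0,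
    braidMatrix_mul_inverse hR hq0, scalarMatrix_one]

theorem reBraid_inv_mul (hR : IsHeckeSymmetry q R) (hq0 : q ≠ 0) {p : ℕ} (i : Fin p) :
    reBraidInv R i * reBraid R i = 1 := by
  rw [reBraid, reBraidInv, ← scalarMatrix_mul, braidMatrix_inv hR hq0,
    inverse_mul_braidMatrix hR hq0, scalarMatrix_one]

theorem commute_of_mul_eq_one {A : Type*} [Monoid A] {r r' x : A} (h : r * r' = 1)
    (h' : r' * r = 1) (hx : Commute x r) : Commute x r' := by
  have := Commute.units_inv_right (u := ⟨r, r', h, h'⟩) (a := x) hx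
  exact this

theorem reBraid_castSucc {p : ℕ} (i : Fin p) : reBraid R i.castSucc = extend (reBraid R i) := by
  rw [reBraid, braidMatrix_castSucc, reBraid, extend_scalarMatrix]

theorem reBraidInv_castSucc (hR : IsHeckeSymmetry q R) (hq0 : q ≠ 0) {p : ℕ} (i : Fin p) :
    reBraidInv R i.castSucc = extend (reBraidInv R i) := by
  rw [reBraidInv, reBraidInv, braidMatrix_inv hR hq0, braidMatrix_inv hR hq0,
    braidMatrix_castSucc, extend_scalarMatrix]

theorem reBraid_braid (hR : IsHeckeSymmetry q R) (p : ℕ) :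
    reBraid R (Fin.last p).castSucc * reBraid R (Fin.last (p + 1)) *
      reBraid R (Fin.last p).castSucc =
    reBraid R (Fin.last (p + 1)) * reBraid R (Fin.last p).castSucc *
      reBraid R (Fin.last (p + 1)) := by
  simp only [reBraid, ← scalarMatrix_mul]
  rw [braidMatrix_braid hR _ _ (by simp)]

/-- The last copy `L_{\overline{p+1}}` on `p + 1` factors. -/
noncomputable def lastCopy (R : Matrix (Fin N × Fin N) (Fin N × Fin N) ℂ) (p : ℕ) :
    Matrix (Fin (p + 1) → Fin N) (Fin (p + 1) → Fin N) (REAlgebra R) :=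
  reCopy R p (Fin.last p)

theorem reCopy_succ (p : ℕ) (i : Fin p) :
    reCopy R p i.succ = reBraid R i * reCopy R p i.castSucc * reBraidInv R i :=
  Fin.induction_succ _ _ _

theorem extend_commute {n : ℕ} {𝓐 : Type} [Ring 𝓐]
    {X Y : Matrix (Fin n → Fin N) (Fin n → Fin N) 𝓐} (h : Commute X Y) :
    Commute (extend X) (extend Y) := by
  rw [Commute, SemiconjBy, ← extend_mul, h.eq, extend_mul]

/-- The copies do not depend on the number of spare factors, which makes induction on that number
possible. -/
theorem reCopy_castSucc (hR : IsHeckeSymmetry q R) (hq0 : q ≠ 0) (p : ℕ) (j : Fin (p + 1)) :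
    reCopy R (p + 1) j.castSucc = extend (reCopy R p j) := by
  induction j using Fin.induction with
  | zero =>
    refine matrix_ext_addLeg fun f a g b => ?_
    have hf : addLeg f a 0 = f 0 := addLeg_castSucc f a 0
    have hg : addLeg g b 0 = g 0 := addLeg_castSucc g b 0
    rw [extend_apply]
    simp only [reCopy, Fin.castSucc_zero, Fin.induction_zero, Matrix.of_apply, hf, hg]
    rw [← ite_and]
    refine if_congr ⟨fun h => ⟨?_, fun c hc => ?_⟩, ?_⟩ rfl rfl
    · have h1 := h (Fin.last _) Fin.last_pos.ne'
      rwa [addLeg_last, addLeg_last] at h1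
    · have h1 := h c.castSucc fun h2 => hc (Fin.castSucc_injective _ h2)
      rwa [addLeg_castSucc, addLeg_castSucc] at h1
    · rintro ⟨rfl, h⟩ c hc
      rcases Fin.eq_castSucc_or_eq_last c with ⟨i, rfl⟩ | rfl
      · rw [addLeg_castSucc, addLeg_castSucc]
        exact h i fun h2 => hc (by rw [h2]; rfl)
      · rw [addLeg_last, addLeg_last]
  | succ i ih =>
    rw [← Fin.succ_castSucc, reCopy_succ, ih, reCopy_succ, extend_mul, extend_mul,
      reBraid_castSucc, reBraidInv_castSucc hR hq0]

theorem lastCopy_succ (hR : IsHeckeSymmetry q R) (hq0 : q ≠ 0) (p : ℕ) :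
    lastCopy R (p + 1) =
      reBraid R (Fin.last p) * extend (lastCopy R p) * reBraidInv R (Fin.last p) := by
  rw [lastCopy, ← Fin.succ_last, reCopy_succ, reCopy_castSucc hR hq0, lastCopy]

theorem reProduct_succ (hR : IsHeckeSymmetry q R) (hq0 : q ≠ 0) (p : ℕ) :
    reProduct R (p + 1) = extend (reProduct R p) * lastCopy R (p + 1) := by
  rw [reProduct, List.ofFn_succ', List.concat_eq_append, List.prod_append, List.prod_singleton,
    reProduct, extend_list_prod, List.map_ofFn, lastCopy]
  congr 3
  funext j
  exact reCopy_castSucc hR hq0 p j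

theorem commute_reBraid_lastCopy (hR : IsHeckeSymmetry q R) (hq0 : q ≠ 0) {p : ℕ} (i : Fin p) :
    Commute (reBraid R i.castSucc) (lastCopy R (p + 1)) := by
  induction p with
  | zero => exact i.elim0
  | succ p ih =>
    rcases Fin.eq_castSucc_or_eq_last i with ⟨i, rfl⟩ | rfl
    · have h1 : Commute (reBraid R i.castSucc.castSucc) (reBraid R (Fin.last (p + 1))) := by
        rw [Commute, SemiconjBy, reBraid, reBraid, ← scalarMatrix_mul,
          braidMatrix_comm R _ _ (by simp), scalarMatrix_mul]
      rw [lastCopy_succ hR hq0]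
      refine (h1.mul_right ?_).mul_right
        (commute_of_mul_eq_one (reBraid_mul_inv hR hq0 _) (reBraid_inv_mul hR hq0 _) h1)
      rw [reBraid_castSucc]
      exact extend_commute (ih i)
    · rw [lastCopy_succ hR hq0 (p + 1), lastCopy_succ hR hq0 p, extend_mul, extend_mul,
        ← reBraidInv_castSucc hR hq0, ← reBraid_castSucc]
      exact commute_conj_conj_of_braid (reBraid_braid hR p) (reBraid_mul_inv hR hq0 _)
        (reBraid_inv_mul hR hq0 _) (reBraid_mul_inv hR hq0 _) (reBraid_inv_mul hR hq0 _)
        (scalar_braidMatrix_last_comm R _)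

/-- The defining relations, carried through the quotient map and reindexed from pairs to
multi-indices of length two. -/
theorem reflection_equation_two_legs :
    reBraid R (0 : Fin 1) * extend (lastCopy R 0) * reBraid R (0 : Fin 1) *
        extend (lastCopy R 0) =
      extend (lastCopy R 0) * reBraid R (0 : Fin 1) * extend (lastCopy R 0) *
        reBraid R (0 : Fin 1) := by
  set φ := RingQuot.mkAlgHom ℂ (RERel R) with hφ
  have h1 : φ.mapMatrix (freeR R * freeLOne N * freeR R * freeLOne N) =
      φ.mapMatrix (freeLOne N * freeR R * freeLOne N * freeR R) := by
    ext r c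
    exact RingQuot.mkAlgHom_rel ℂ (RERel.rel r c)
  simp only [map_mul] at h1
  have h2 := congrArg (Matrix.reindexRingEquiv (REAlgebra R) (finTwoArrowEquiv (Fin N)).symm) h1
  simp only [map_mul] at h2
  have e1 : Matrix.reindexRingEquiv (REAlgebra R) (finTwoArrowEquiv (Fin N)).symm
      (φ.mapMatrix (freeR R)) = reBraid R (0 : Fin 1) := by
    ext f g
    have h3 : braidMatrix R (0 : Fin 1) f g = R (f 0, f 1) (g 0, g 1) := by
      rw [braidMatrix, onLegs_apply_of_iff _ _ _ _ True, if_pos trivial]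
      · simp [twoLegs]
      · refine iff_true_intro fun j hj => absurd ?_ hj
        fin_cases j
        · exact ⟨0, rfl⟩
        · exact ⟨1, rfl⟩
    rw [reBraid, scalarMatrix, Matrix.map_apply, h3]
    simp [freeR, scalarMatrix]
  have e2 : Matrix.reindexRingEquiv (REAlgebra R) (finTwoArrowEquiv (Fin N)).symm
      (φ.mapMatrix (freeLOne N)) = extend (lastCopy R 0) := by
    ext f g
    simp only [freeLOne, extend, lastCopy, reCopy, Matrix.coe_reindexRingEquiv,
      Matrix.reindex_apply, Equiv.symm_symm, finTwoArrowEquiv_apply, AlgHom.mapMatrix_apply,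
      Matrix.submatrix_apply, Matrix.map_apply, Matrix.of_apply, apply_ite φ, map_zero]
    refine if_congr Iff.rfl ?_ rfl
    change _ = if ∀ a : Fin 1, a ≠ 0 → Fin.init f a = Fin.init g a then
      reGen R (Fin.init f 0) (Fin.init g 0) else 0
    rw [if_pos fun a ha => absurd (Subsingleton.elim a 0) ha]
    rfl
  rw [e1, e2] at h2
  exact h2

theorem reflection_equation (hR : IsHeckeSymmetry q R) (hq0 : q ≠ 0) (p : ℕ) :
    reBraid R (Fin.last p) * extend (lastCopy R p) * reBraid R (Fin.last p) *
        extend (lastCopy R p) =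
      extend (lastCopy R p) * reBraid R (Fin.last p) * extend (lastCopy R p) *
        reBraid R (Fin.last p) := by
  induction p with
  | zero => exact reflection_equation_two_legs
  | succ p ih =>
    have h2 := congrArg extend ih
    simp only [extend_mul, ← reBraid_castSucc] at h2
    rw [lastCopy_succ hR hq0 p, extend_mul, extend_mul, ← reBraidInv_castSucc hR hq0,
      ← reBraid_castSucc]
    exact reflection_conj_of_braid (reBraid_braid hR p) (reBraid_mul_inv hR hq0 _)
      (reBraid_inv_mul hR hq0 _) (reBraid_mul_inv hR hq0 _) (reBraid_inv_mul hR hq0 _)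
      (scalar_braidMatrix_last_comm R _) h2

/-- The product `L_{\bar 1} ⋯ L_{\bar p}` on `p + 1` factors. -/
noncomputable def initProduct (R : Matrix (Fin N × Fin N) (Fin N × Fin N) ℂ) :
    (p : ℕ) → Matrix (Fin (p + 1) → Fin N) (Fin (p + 1) → Fin N) (REAlgebra R)
  | 0 => 1
  | p + 1 => extend (reProduct R p)

theorem reProduct_eq (hR : IsHeckeSymmetry q R) (hq0 : q ≠ 0) (p : ℕ) :
    reProduct R p = initProduct R p * lastCopy R p := by
  cases p with
  | zero => simp [reProduct, initProduct, lastCopy]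
  | succ p => exact reProduct_succ hR hq0 p

theorem commute_reBraid_initProduct (p : ℕ) :
    Commute (reBraid R (Fin.last p)) (extend (initProduct R p)) := by
  cases p with
  | zero => rw [initProduct, extend_one]; exact Commute.one_right _
  | succ p => exact scalar_braidMatrix_last_comm R _

/-- For the last braid matrix `r`, the reflection equation says that `r` commutes with `l * (r * l *
r')`, the product of the last two copies. The earlier ones commute with the last copy and, by
induction, with the product of the others. -/
theorem commute_reBraid_reProduct (hR : IsHeckeSymmetry q R) (hq0 : q ≠ 0) {p : ℕ} (i : Fin p) :
    Commute (reBraid R i) (reProduct R p) := by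
  induction p with
  | zero => exact i.elim0
  | succ p ih =>
    rw [reProduct_succ hR hq0]
    rcases Fin.eq_castSucc_or_eq_last i with ⟨i, rfl⟩ | rfl
    · refine Commute.mul_right ?_ (commute_reBraid_lastCopy hR hq0 i)
      rw [reBraid_castSucc]
      exact extend_commute (ih i)
    · rw [reProduct_eq hR hq0, extend_mul, mul_assoc, lastCopy_succ hR hq0]
      refine (commute_reBraid_initProduct p).mul_right ?_
      have h1 := reflection_equation hR hq0 p
      have h2 := reBraid_mul_inv hR hq0 (Fin.last p)
      have h3 := reBraid_inv_mul hR hq0 (Fin.last p)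
      generalize reBraid R (Fin.last p) = r at *
      generalize reBraidInv R (Fin.last p) = r' at *
      generalize extend (lastCopy R p) = l at *
      calc r * (l * (r * l * r')) = (r * l * r * l) * r' := by simp only [mul_assoc]
        _ = l * r * l * (r * r') := by rw [h1]; simp only [mul_assoc]
        _ = l * (r * l * (r' * r)) := by rw [h2, h3]; simp only [mul_assoc]
        _ = l * (r * l * r') * r := by simp only [mul_assoc]

end Copies

/-! ### From the generators to the whole Hecke algebra. -/

section HeckeCommutant

variable {N : ℕ} {q : ℂ} {R : Matrix (Fin N × Fin N) (Fin N × Fin N) ℂ}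

theorem heckeRep_heckeGen (hR : IsHeckeSymmetry q R) {p : ℕ} (i : Fin p) :
    heckeRep hR p (heckeGen q i) = braidMatrix R i := by
  simp [heckeRep, heckeGen]

theorem hecke_induction {p : ℕ} {P : HeckeAlgebra q p → Prop} (z : HeckeAlgebra q p)
    (hc : ∀ c : ℂ, P (algebraMap ℂ _ c)) (hg : ∀ i, P (heckeGen q i))
    (hm : ∀ x y, P x → P y → P (x * y)) (ha : ∀ x y, P x → P y → P (x + y)) : P z := by
  obtain ⟨w, rfl⟩ := RingQuot.mkAlgHom_surjective ℂ (HeckeRel q p) z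
  induction w using FreeAlgebra.induction with
  | grade0 c => rw [AlgHom.commutes]; exact hc c
  | grade1 i => exact hg i
  | mul a b iha ihb => rw [map_mul]; exact hm _ _ iha ihb
  | add a b iha ihb => rw [map_add]; exact ha _ _ iha ihb

theorem commute_scalar_heckeRep {𝓐 : Type} [Ring 𝓐] [Algebra ℂ 𝓐] (hR : IsHeckeSymmetry q R)
    {p : ℕ} {T : Matrix (Fin (p + 1) → Fin N) (Fin (p + 1) → Fin N) 𝓐}
    (hT : ∀ i, Commute (scalarMatrix 𝓐 (braidMatrix R i)) T) (z : HeckeAlgebra q p) :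
    Commute (scalarMatrix 𝓐 (heckeRep hR p z)) T := by
  induction z using hecke_induction with
  | hc c =>
    rw [AlgHom.commutes, Algebra.algebraMap_eq_smul_one, scalarMatrix_smul, scalarMatrix_one]
    exact (Commute.one_left T).smul_left c
  | hg i => rw [heckeRep_heckeGen]; exact hT i
  | hm x y hx hy => rw [map_mul, scalarMatrix_mul]; exact hx.mul_left hy
  | ha x y hx hy => rw [map_add, scalarMatrix_add]; exact hx.add_left hy

end HeckeCommutant

/-! ### Hook traces -/

section HookTrace

variable {N : ℕ} {q : ℂ} {R Ψ : Matrix (Fin N × Fin N) (Fin N × Fin N) ℂ}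

/-- The trace `⟨L^j⟩_1`. -/
noncomputable def tracePower (R Ψ : Matrix (Fin N × Fin N) (Fin N × Fin N) ℂ) (j : ℕ) :
    REAlgebra R :=
  rTrace Ψ (lastCopy R 0 ^ j)

theorem extend_diagonal {n : ℕ} {𝓐 : Type} [Ring 𝓐] (c : 𝓐) :
    extend (Matrix.diagonal fun _ : Fin n → Fin N => c) = Matrix.diagonal fun _ => c := by
  refine matrix_ext_addLeg fun f a g b => ?_
  simp only [extend_apply, Matrix.diagonal_apply, addLeg_inj]
  split_ifs <;> simp_all

theorem rTrace_mul_diagonal {n : ℕ} {𝓐 : Type} [Ring 𝓐] [Algebra ℂ 𝓐]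
    (X : Matrix (Fin n → Fin N) (Fin n → Fin N) 𝓐) (c : 𝓐) :
    rTrace Ψ (X * Matrix.diagonal fun _ => c) = rTrace Ψ X * c := by
  rw [rTrace, ← mul_assoc]
  simp [rTrace, Matrix.trace, Matrix.mul_diagonal, Finset.sum_mul]

theorem lastCopy_succ_pow (hR : IsHeckeSymmetry q R) (hq0 : q ≠ 0) (p j : ℕ) :
    lastCopy R (p + 1) ^ j =
      reBraid R (Fin.last p) * extend (lastCopy R p ^ j) * reBraidInv R (Fin.last p) := by
  induction j with
  | zero => simp [extend_one, reBraid_mul_inv hR hq0]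
  | succ j ih =>
    have h := reBraid_inv_mul hR hq0 (Fin.last p)
    rw [pow_succ, ih, lastCopy_succ hR hq0, pow_succ, extend_mul]
    generalize reBraid R (Fin.last p) = r at *
    generalize reBraidInv R (Fin.last p) = r' at *
    generalize extend (lastCopy R p) = l at *
    generalize extend (lastCopy R p ^ j) = k at *
    calc r * k * r' * (r * l * r') = r * k * (r' * r) * l * r' := by simp only [mul_assoc]
      _ = r * (k * l) * r' := by rw [h, mul_one]; simp only [mul_assoc]

/-- The last copy is a conjugate of the previous one, and the conjugation formula moves the trace
down one factor at a time until it becomes the trace of `L^j` on the first. -/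
theorem partialTrace_lastCopy_pow (hR : IsHeckeSymmetry q R) (hq0 : q ≠ 0)
    (hΨ : IsSkewInverse R Ψ) (p j : ℕ) :
    partialTrace (traceMatrix Ψ) (lastCopy R p ^ j) =
      Matrix.diagonal fun _ => tracePower R Ψ j := by
  induction p with
  | zero =>
    ext f g
    rw [Subsingleton.elim g f, tracePower, rTrace_eq_rTrace_partialTrace]
    simp [rTrace, Matrix.trace, scalarMatrix, Subsingleton.elim f default, Matrix.mul_apply]
  | succ p ih =>
    rw [lastCopy_succ_pow hR hq0, reBraid, reBraidInv, hR.partialTrace_conj hq0 hΨ, ih,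
      extend_diagonal]

/-- The trace `⟨X L_{\bar 1} ⋯ L_{\bar p} L_{\overline{p+1}}^j⟩_{1…p+1}`. -/
noncomputable def hookTrace (R Ψ : Matrix (Fin N × Fin N) (Fin N × Fin N) ℂ) (p j : ℕ)
    (X : Matrix (Fin (p + 1) → Fin N) (Fin (p + 1) → Fin N) ℂ) : REAlgebra R :=
  rTrace Ψ (scalarMatrix _ X * (initProduct R p * lastCopy R p ^ j))

theorem rTrace_add {n : ℕ} {𝓐 : Type} [Ring 𝓐] [Algebra ℂ 𝓐]
    (X Y : Matrix (Fin n → Fin N) (Fin n → Fin N) 𝓐) :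
    rTrace Ψ (X + Y) = rTrace Ψ X + rTrace Ψ Y := by
  rw [rTrace, mul_add, Matrix.trace_add, rTrace, rTrace]

theorem rTrace_smul {n : ℕ} {𝓐 : Type} [Ring 𝓐] [Algebra ℂ 𝓐] (c : ℂ)
    (X : Matrix (Fin n → Fin N) (Fin n → Fin N) 𝓐) :
    rTrace Ψ (c • X) = c • rTrace Ψ X := by
  rw [rTrace, Matrix.mul_smul, Matrix.trace_smul, rTrace]

theorem hookTrace_sub (p j : ℕ) (X Y : Matrix (Fin (p + 1) → Fin N) (Fin (p + 1) → Fin N) ℂ) :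
    hookTrace R Ψ p j (X - Y) = hookTrace R Ψ p j X - hookTrace R Ψ p j Y := by
  have h : X = (X - Y) + Y := (sub_add_cancel X Y).symm
  conv_rhs => rw [h]
  rw [hookTrace, hookTrace, hookTrace, scalarMatrix_add (X - Y), add_mul, rTrace_add,
    add_sub_cancel_right]

theorem hookTrace_smul (p j : ℕ) (c : ℂ)
    (X : Matrix (Fin (p + 1) → Fin N) (Fin (p + 1) → Fin N) ℂ) :
    hookTrace R Ψ p j (c • X) = c • hookTrace R Ψ p j X := by
  rw [hookTrace, scalarMatrix_smul, smul_mul_assoc, rTrace_smul, hookTrace]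

theorem hookTrace_one (hR : IsHeckeSymmetry q R) (hq0 : q ≠ 0) (p : ℕ)
    (X : Matrix (Fin (p + 1) → Fin N) (Fin (p + 1) → Fin N) ℂ) :
    hookTrace R Ψ p 1 X = rTrace Ψ (scalarMatrix _ X * reProduct R p) := by
  rw [hookTrace, pow_one, reProduct_eq hR hq0]

theorem hookTrace_zero_one (j : ℕ) : hookTrace R Ψ 0 j 1 = tracePower R Ψ j := by
  rw [hookTrace, scalarMatrix_one, initProduct, one_mul, one_mul, tracePower]

theorem hookTrace_extend (hR : IsHeckeSymmetry q R) (hq0 : q ≠ 0) (hΨ : IsSkewInverse R Ψ)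
    (p j : ℕ) (X : Matrix (Fin (p + 1) → Fin N) (Fin (p + 1) → Fin N) ℂ) :
    hookTrace R Ψ (p + 1) j (extend X) = hookTrace R Ψ p 1 X * tracePower R Ψ j := by
  rw [hookTrace_one hR hq0, hookTrace, initProduct, rTrace_eq_rTrace_partialTrace, ← mul_assoc,
    ← extend_scalarMatrix, ← extend_mul, partialTrace_extend_mul,
    partialTrace_lastCopy_pow hR hq0 hΨ, rTrace_mul_diagonal]

/-- The braid matrix turns the last copy into the preceding one, L_{p+2}^j R = R L_{p+1}^j. The last
factor then carries only R, whose partial trace is 1, and the freed power joins the L_{p+1} already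
in the product. -/
theorem rTrace_mul_reBraid (hR : IsHeckeSymmetry q R) (hq0 : q ≠ 0) (hΨ : IsSkewInverse R Ψ)
    (p j : ℕ) (X : Matrix (Fin (p + 1) → Fin N) (Fin (p + 1) → Fin N) ℂ) :
    rTrace Ψ (scalarMatrix _ (extend X) * (initProduct R (p + 1) * lastCopy R (p + 1) ^ j) *
      reBraid R (Fin.last p)) = hookTrace R Ψ p (j + 1) X := by
  have h : lastCopy R (p + 1) ^ j * reBraid R (Fin.last p) =
      reBraid R (Fin.last p) * extend (lastCopy R p ^ j) := by
    rw [lastCopy_succ_pow hR hq0, mul_assoc, reBraid_inv_mul hR hq0, mul_one]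
  rw [mul_assoc, mul_assoc, h, initProduct, rTrace_eq_rTrace_partialTrace, ← extend_scalarMatrix,
    partialTrace_extend_mul, partialTrace_extend_mul, partialTrace_mul_extend, reBraid,
    partialTrace_scalarMatrix, hΨ.partialTrace_braidMatrix, scalarMatrix_one, one_mul, hookTrace,
    reProduct_eq hR hq0, pow_succ', mul_assoc]

theorem hookTrace_braid_mul (hR : IsHeckeSymmetry q R) (hq0 : q ≠ 0) (hΨ : IsSkewInverse R Ψ)
    (p j : ℕ) (X : Matrix (Fin (p + 1) → Fin N) (Fin (p + 1) → Fin N) ℂ) :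
    hookTrace R Ψ (p + 1) j (braidMatrix R (Fin.last p) * extend X) =
      hookTrace R Ψ p (j + 1) X := by
  rw [hookTrace, scalarMatrix_mul, mul_assoc,
    rTrace_scalar_mul_comm (hR.commute_tensorPower hq0 hΨ _)]
  exact rTrace_mul_reBraid hR hq0 hΨ p j X

theorem IsHeckeSymmetry.heckeRep_commute_tensorPower (hR : IsHeckeSymmetry q R) (hq0 : q ≠ 0)
    (hΨ : IsSkewInverse R Ψ) {p : ℕ} (z : HeckeAlgebra q p) :
    Commute (heckeRep hR p z) (tensorPower (traceMatrix Ψ) (p + 1)) := by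
  have h := commute_scalar_heckeRep (𝓐 := ℂ) hR
    (fun i => by rw [scalarMatrix_complex]; exact hR.commute_tensorPower hq0 hΨ i) z
  rwa [scalarMatrix_complex] at h

theorem scalar_heckeRep_commute_lastCopy (hR : IsHeckeSymmetry q R) (hq0 : q ≠ 0) {p : ℕ}
    (z : HeckeAlgebra q p) :
    Commute (scalarMatrix _ (extend (heckeRep hR p z))) (lastCopy R (p + 1)) := by
  induction z using hecke_induction with
  | hc c =>
    rw [AlgHom.commutes, Algebra.algebraMap_eq_smul_one, extend_smul, extend_one,
      scalarMatrix_smul, scalarMatrix_one]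
    exact (Commute.one_left _).smul_left c
  | hg i =>
    rw [heckeRep_heckeGen, ← braidMatrix_castSucc]
    exact commute_reBraid_lastCopy hR hq0 i
  | hm x y hx hy =>
    rw [map_mul, extend_mul, scalarMatrix_mul]
    exact hx.mul_left hy
  | ha x y hx hy =>
    rw [map_add, extend_add, scalarMatrix_add]
    exact hx.add_left hy

/-- The right-hand `X` commutes past `Q`, the left-hand one comes around by cyclicity, and
idempotence merges them. -/
theorem rTrace_conj_idempotent {n : ℕ} {𝓐 : Type} [Ring 𝓐] [Algebra ℂ 𝓐]
    {X Y : Matrix (Fin n → Fin N) (Fin n → Fin N) ℂ}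
    {Q : Matrix (Fin n → Fin N) (Fin n → Fin N) 𝓐}
    (hX : Commute X (tensorPower (traceMatrix Ψ) n))
    (hY : Commute Y (tensorPower (traceMatrix Ψ) n)) (hXX : X * X = X)
    (hQ : Commute (scalarMatrix 𝓐 X) Q) :
    rTrace Ψ (scalarMatrix 𝓐 (X * Y * X) * Q) =
      rTrace Ψ (scalarMatrix 𝓐 X * Q * scalarMatrix 𝓐 Y) := by
  calc rTrace Ψ (scalarMatrix 𝓐 (X * Y * X) * Q)
      = rTrace Ψ (scalarMatrix 𝓐 X * (scalarMatrix 𝓐 Y * (scalarMatrix 𝓐 X * Q))) := by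
        simp only [scalarMatrix_mul, mul_assoc]
    _ = rTrace Ψ (scalarMatrix 𝓐 Y * (Q * scalarMatrix 𝓐 X) * scalarMatrix 𝓐 X) := by
        rw [rTrace_scalar_mul_comm hX, hQ.eq]
    _ = rTrace Ψ (scalarMatrix 𝓐 Y * (Q * scalarMatrix 𝓐 (X * X))) := by
        simp only [scalarMatrix_mul, mul_assoc]
    _ = rTrace Ψ (scalarMatrix 𝓐 X * Q * scalarMatrix 𝓐 Y) := by
        rw [hXX, rTrace_scalar_mul_comm hY, ← hQ.eq]

theorem hookTrace_conj_braid (hR : IsHeckeSymmetry q R) (hq0 : q ≠ 0) (hΨ : IsSkewInverse R Ψ)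
    (p j : ℕ) {z : HeckeAlgebra q p} (hz : heckeRep hR p z * heckeRep hR p z = heckeRep hR p z) :
    hookTrace R Ψ (p + 1) j (extend (heckeRep hR p z) * braidMatrix R (Fin.last p) *
      extend (heckeRep hR p z)) = hookTrace R Ψ p (j + 1) (heckeRep hR p z) := by
  have hT := extend_comm_tensorPower _ (hR.heckeRep_commute_tensorPower hq0 hΨ z)
  have hQ : Commute (scalarMatrix (REAlgebra R) (extend (heckeRep hR p z)))
      (initProduct R (p + 1) * lastCopy R (p + 1) ^ j) := by
    refine Commute.mul_right ?_ ((scalar_heckeRep_commute_lastCopy hR hq0 z).pow_right j)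
    rw [← extend_scalarMatrix]
    exact extend_commute (commute_scalar_heckeRep hR (commute_reBraid_reProduct hR hq0) z)
  rw [← rTrace_mul_reBraid hR hq0 hΨ, hookTrace]
  exact rTrace_conj_idempotent hT (hR.commute_tensorPower hq0 hΨ _)
    (by rw [← extend_mul, hz]) hQ

end HookTrace

/-! ### Power sums -/

section PowerSums

variable {N : ℕ} {q : ℂ} {R Ψ : Matrix (Fin N × Fin N) (Fin N × Fin N) ℂ}

theorem heckeGen_hecke {p : ℕ} (i : Fin p) :
    (q • 1 - heckeGen q i) * (q⁻¹ • 1 + heckeGen q i) = 0 := by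
  have := RingQuot.mkAlgHom_rel ℂ (HeckeRel.hecke (q := q) i)
  simpa [heckeGen] using this

theorem ringInverse_heckeGen (hq0 : q ≠ 0) {p : ℕ} (i : Fin p) :
    Ring.inverse (heckeGen q i) = heckeGen q i - (q - q⁻¹) • 1 := by
  have h := heckeGen_hecke (q := q) i
  exact Ring.inverse_unit ⟨_, _, mul_sub_smul_one_of_hecke hq0 h, sub_smul_one_mul_of_hecke hq0 h⟩

theorem descending_prod_succ (S : Matrix (Fin N × Fin N) (Fin N × Fin N) ℂ) (p : ℕ) :
    (List.ofFn fun i : Fin (p + 1) => braidMatrix S i).reverse.prod =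
      braidMatrix S (Fin.last p) *
        extend (List.ofFn fun i : Fin p => braidMatrix S i).reverse.prod := by
  rw [List.ofFn_succ', List.concat_eq_append, List.reverse_append, List.reverse_singleton,
    List.singleton_append, List.prod_cons, extend_list_prod, List.map_reverse, List.map_ofFn]
  congr 4
  funext i
  exact braidMatrix_castSucc S i

theorem powerSumFirst_succ (hR : IsHeckeSymmetry q R) (hq0 : q ≠ 0) (p : ℕ) :
    powerSumFirst hR Ψ (p + 1) =
      hookTrace R Ψ p 1 (List.ofFn fun i : Fin p => braidMatrix R i).reverse.prod := by
  rw [powerSumFirst, charMap, hookTrace_one hR hq0, map_list_prod, List.map_reverse,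
    List.map_ofFn]
  have h : (heckeRep hR p ∘ fun i => heckeGen q i) = fun i => braidMatrix R i :=
    funext fun i => heckeRep_heckeGen hR i
  rw [h]

theorem powerSumSecond_succ (hR : IsHeckeSymmetry q R) (hq0 : q ≠ 0) (p : ℕ) :
    powerSumSecond hR Ψ (p + 1) =
      hookTrace R Ψ p 1
        (List.ofFn fun i : Fin p => braidMatrix (R - (q - q⁻¹) • 1) i).reverse.prod := by
  rw [powerSumSecond, charMap, hookTrace_one hR hq0, map_list_prod, List.map_reverse,
    List.map_ofFn]
  have h : (heckeRep hR p ∘ fun i => Ring.inverse (heckeGen q i)) =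
      fun i => braidMatrix (R - (q - q⁻¹) • 1) i := by
    funext i
    rw [Function.comp_apply, ringInverse_heckeGen hq0, map_sub, map_smul, map_one,
      heckeRep_heckeGen, braidMatrix_sub_smul_one]
  rw [h]

theorem powerSumFirst_eq_tracePower (hR : IsHeckeSymmetry q R) (hq0 : q ≠ 0)
    (hΨ : IsSkewInverse R Ψ) (p : ℕ) :
    powerSumFirst hR Ψ (p + 1) = tracePower R Ψ (p + 1) := by
  -- The exponent `j` must be free: each removed factor raises it by one.
  have h : ∀ p j, hookTrace R Ψ p j (List.ofFn fun i : Fin p => braidMatrix R i).reverse.prod =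
      tracePower R Ψ (p + j) := by
    intro p
    induction p with
    | zero => intro j; simpa using hookTrace_zero_one j
    | succ p ih =>
      intro j
      rw [descending_prod_succ, hookTrace_braid_mul hR hq0 hΨ, ih, add_right_comm, add_assoc]
  rw [powerSumFirst_succ hR hq0, h]

/-- Writing the leading R⁻¹ as R - ω, the R part lowers `p` and raises `j`, while the ω part splits
off a product of t_{p+1} and s_j. Unrolling in `p` collects these products. -/
theorem tracePower_eq_powerSumSecond_add (hR : IsHeckeSymmetry q R) (hq0 : q ≠ 0)
    (hΨ : IsSkewInverse R Ψ) (n : ℕ) :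
    tracePower R Ψ (n + 1) = powerSumSecond hR Ψ (n + 1) + (q - q⁻¹) •
      ∑ k ∈ Finset.range n, powerSumSecond hR Ψ (k + 1) * tracePower R Ψ (n - k) := by
  have h : ∀ p j, tracePower R Ψ (p + j) =
      hookTrace R Ψ p j
        (List.ofFn fun i : Fin p => braidMatrix (R - (q - q⁻¹) • 1) i).reverse.prod +
      (q - q⁻¹) •
        ∑ k ∈ Finset.range p, powerSumSecond hR Ψ (k + 1) * tracePower R Ψ (p + j - (k + 1)) := by
    intro p
    induction p with
    | zero => intro j; simpa using (hookTrace_zero_one j).symm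
    | succ p ih =>
      intro j
      have h1 := ih (j + 1)
      rw [descending_prod_succ, braidMatrix_sub_smul_one, sub_mul, smul_mul_assoc, one_mul,
        hookTrace_sub, hookTrace_braid_mul hR hq0 hΨ, hookTrace_smul,
        hookTrace_extend hR hq0 hΨ, ← powerSumSecond_succ hR hq0, Finset.sum_range_succ,
        smul_add]
      have e1 : p + 1 + j = p + (j + 1) := by ring
      have e2 : p + (j + 1) - (p + 1) = j := by omega
      rw [e1, h1, e2]
      abel
  rw [h n 1, powerSumSecond_succ hR hq0]
  simp only [Nat.add_sub_add_right]

end PowerSums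

/-! ### The `q`-antisymmetrizer -/

section QNumber

variable {q : ℂ}

theorem sub_inv_ne_zero_of_generic (hq0 : q ≠ 0) (hq : ∀ k : ℕ, 1 ≤ k → q ^ k ≠ 1) :
    q - q⁻¹ ≠ 0 := by
  intro h
  have h1 : q * q⁻¹ = 1 := mul_inv_cancel₀ hq0
  rw [← sub_eq_zero.mp h] at h1
  exact hq 2 (by norm_num) (by rw [pow_two, h1])

theorem qNumber_mul (hq0 : q ≠ 0) (hq : ∀ k : ℕ, 1 ≤ k → q ^ k ≠ 1) (n : ℕ) :
    qNumber q n * (q - q⁻¹) = q ^ n - q⁻¹ ^ n :=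
  div_mul_cancel₀ _ (sub_inv_ne_zero_of_generic hq0 hq)

theorem qNumber_ne_zero (hq0 : q ≠ 0) (hq : ∀ k : ℕ, 1 ≤ k → q ^ k ≠ 1) (n : ℕ) :
    qNumber q (n + 1) ≠ 0 := by
  refine div_ne_zero (fun h => ?_) (sub_inv_ne_zero_of_generic hq0 hq)
  have h1 : q ^ (n + 1) * q⁻¹ ^ (n + 1) = 1 := by rw [← mul_pow, mul_inv_cancel₀ hq0, one_pow]
  rw [← sub_eq_zero.mp h, ← pow_add] at h1
  exact hq _ (by omega) h1

theorem qNumber_succ (hq0 : q ≠ 0) (hq : ∀ k : ℕ, 1 ≤ k → q ^ k ≠ 1) (n : ℕ) :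
    qNumber q (n + 1) = q ^ n + q⁻¹ * qNumber q n := by
  have h := sub_inv_ne_zero_of_generic hq0 hq
  apply mul_right_cancel₀ h
  rw [add_mul, mul_assoc, qNumber_mul hq0 hq, qNumber_mul hq0 hq, pow_succ, pow_succ]
  ring

theorem qNumber_one (hq0 : q ≠ 0) (hq : ∀ k : ℕ, 1 ≤ k → q ^ k ≠ 1) : qNumber q 1 = 1 := by
  rw [qNumber, pow_one, pow_one, div_self (sub_inv_ne_zero_of_generic hq0 hq)]

end QNumber

section Antisymmetrizer

variable {q : ℂ} {A : Type*} [Ring A] [Algebra ℂ A]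

/-- Here `a = A^{(k)}`, `b = A^{(k-1)}`, `s = τ_k`, `t = τ_{k-1}`, with `c = q^{k-1}`, `d =
(k-1)_q`, `e = k_q`. Expanding the left `a` by its recursion makes the element c(q - s)a + d·b t s
a. The Hecke relation gives the eigenvalue -q⁻¹ on the first term; on the second, s b t s a = b t s
t a by the braid relation, and `t` acts on `a` by -q⁻¹. -/
theorem hecke_absorb (hq0 : q ≠ 0) {c e d : ℂ} {a b s t : A}
    (haa : a * a = a) (hba : b * a = a)
    (hab : e • a = b * (c • 1 - d • t) * b)
    (hbs : s * b = b * s) (hta : t * a = (-q⁻¹) • a) (hst : s * t * s = t * s * t)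
    (hs : s * s = 1 + (q - q⁻¹) • s) :
    s * (a * ((q * c) • 1 - e • s) * a) =
      (-q⁻¹) • (a * ((q * c) • 1 - e • s) * a) := by
  have h1 : e • (a * s * a) = c • (s * a) - d • (b * (t * (s * a))) := by
    calc e • (a * s * a) = (e • a) * s * a := by simp only [smul_mul_assoc]
      _ = b * (c • 1 - d • t) * (b * s) * a := by rw [hab]; simp only [mul_assoc]
      _ = b * (c • 1 - d • t) * s * (b * a) := by rw [← hbs]; simp only [mul_assoc]
      _ = c • ((b * s) * a) - d • (b * (t * (s * a))) := by
        rw [hba]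
        simp only [mul_sub, sub_mul, smul_mul_assoc, mul_smul_comm, mul_one, mul_assoc]
      _ = _ := by rw [← hbs, mul_assoc s b a, hba]
  have h2 : a * ((q * c) • 1 - e • s) * a =
      (q * c) • a - c • (s * a) + d • (b * (t * (s * a))) := by
    rw [mul_sub, sub_mul, mul_smul_comm, mul_smul_comm, smul_mul_assoc, smul_mul_assoc, mul_one,
      haa, h1]
    abel
  have h3 : s * (b * (t * (s * a))) = (-q⁻¹) • (b * (t * (s * a))) := by
    calc s * (b * (t * (s * a))) = (s * b) * (t * (s * a)) := by simp only [mul_assoc]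
      _ = b * (s * t * s) * a := by rw [hbs]; simp only [mul_assoc]
      _ = b * (t * (s * (t * a))) := by rw [hst]; simp only [mul_assoc]
      _ = _ := by rw [hta]; simp only [mul_smul_comm]
  have h4 : s * (s * a) = a + (q - q⁻¹) • (s * a) := by
    rw [← mul_assoc, hs, add_mul, one_mul, smul_mul_assoc]
  rw [h2, mul_add, mul_sub, mul_smul_comm, mul_smul_comm, mul_smul_comm, h3, h4]
  generalize b * (t * (s * a)) = x
  generalize s * a = y
  have hqq : q⁻¹ * q = 1 := inv_mul_cancel₀ hq0
  match_scalars <;> first | ring1 | linear_combination c * hqq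

/-- On `x` the middle factor of the recursion acts by q^n + q⁻¹ n_q = (n+1)_q, which cancels the
normalisation. -/
theorem isIdempotent_of_absorb (hq0 : q ≠ 0) (hq : ∀ k : ℕ, 1 ≤ k → q ^ k ≠ 1) (n : ℕ)
    {a s x : A} (haa : a * a = a)
    (hx : x = (qNumber q (n + 1))⁻¹ • (a * (q ^ n • 1 - qNumber q n • s) * a))
    (hs : s * x = (-q⁻¹) • x) : x * x = x := by
  have hax : a * x = x := by
    rw [hx, mul_smul_comm, mul_assoc, ← mul_assoc a a, haa]
  have h1 : (q ^ n • 1 - qNumber q n • s) * x = qNumber q (n + 1) • x := by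
    rw [sub_mul, smul_mul_assoc, smul_mul_assoc, one_mul, hs, qNumber_succ hq0 hq]
    module
  calc x * x = (qNumber q (n + 1))⁻¹ • (a * (q ^ n • 1 - qNumber q n • s) * a) * x := by
        rw [← hx]
    _ = (qNumber q (n + 1))⁻¹ • (a * ((q ^ n • 1 - qNumber q n • s) * x)) := by
        rw [smul_mul_assoc, mul_assoc, hax, mul_assoc]
    _ = x := by
        rw [h1, mul_smul_comm, hax, smul_smul, inv_mul_cancel₀ (qNumber_ne_zero hq0 hq n),
          one_smul]

theorem hecke_absorb_one (hq0 : q ≠ 0) {s : A} (hs : s * s = 1 + (q - q⁻¹) • s) :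
    s * (q • 1 - s) = (-q⁻¹) • (q • 1 - s) := by
  rw [mul_sub, mul_smul_comm, mul_one, hs]
  have h : q⁻¹ * q = 1 := inv_mul_cancel₀ hq0
  match_scalars <;> first | ring1 | linear_combination h

theorem heckeGen_braid {p : ℕ} (i j : Fin p) (h : (i : ℕ) + 1 = j) :
    heckeGen q i * heckeGen q j * heckeGen q i = heckeGen q j * heckeGen q i * heckeGen q j := by
  have := RingQuot.mkAlgHom_rel ℂ (HeckeRel.braid (q := q) i j h)
  simpa [heckeGen] using this

theorem heckeGen_comm {p : ℕ} (i j : Fin p) (h : (i : ℕ) + 2 ≤ j) :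
    heckeGen q i * heckeGen q j = heckeGen q j * heckeGen q i := by
  have := RingQuot.mkAlgHom_rel ℂ (HeckeRel.comm (q := q) i j h)
  simpa [heckeGen] using this

theorem heckeGen_sq (hq0 : q ≠ 0) {p : ℕ} (i : Fin p) :
    heckeGen q i * heckeGen q i = 1 + (q - q⁻¹) • heckeGen q i := by
  have := mul_sub_smul_one_of_hecke hq0 (heckeGen_hecke i)
  rwa [mul_sub, mul_smul_comm, mul_one, sub_eq_iff_eq_add] at this

theorem antisymmetrizer_succ {p : ℕ} (i : Fin p) :
    antisymmetrizer q p i.succ = (qNumber q (i + 2))⁻¹ •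
      (antisymmetrizer q p i.castSucc *
        (q ^ ((i : ℕ) + 1) • 1 - qNumber q (i + 1) • heckeGen q i) *
        antisymmetrizer q p i.castSucc) :=
  Fin.induction_succ _ _ _

theorem heckeGen_commute_antisymmetrizer {p : ℕ} (k : Fin p) (j : Fin (p + 1))
    (h : (j : ℕ) + 1 ≤ k) : Commute (heckeGen q k) (antisymmetrizer q p j) := by
  induction j using Fin.induction with
  | zero => exact Commute.one_right _
  | succ i ih =>
    simp only [Fin.val_succ] at h
    have h1 := ih (by simp; omega)
    have h2 : Commute (heckeGen q k) (heckeGen q i) := (heckeGen_comm i k (by omega)).symm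
    rw [antisymmetrizer_succ]
    exact ((h1.mul_right (((Commute.one_right _).smul_right _).sub_right
      (h2.smul_right _))).mul_right h1).smul_right _

/-- Idempotence and absorption depend on each other. Absorbing the newest generator looks two
antisymmetrizers back, so the third clause carries the idempotence of the previous one through the
induction. -/
theorem antisymmetrizer_spec (hq0 : q ≠ 0) (hq : ∀ k : ℕ, 1 ≤ k → q ^ k ≠ 1) {p : ℕ}
    (j : Fin (p + 1)) :
    antisymmetrizer q p j * antisymmetrizer q p j = antisymmetrizer q p j ∧
      (∀ k : Fin p, (k : ℕ) + 1 ≤ j →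
        heckeGen q k * antisymmetrizer q p j = (-q⁻¹) • antisymmetrizer q p j) ∧
      ∀ k : Fin p, k.succ = j → antisymmetrizer q p k.castSucc * antisymmetrizer q p k.castSucc =
        antisymmetrizer q p k.castSucc := by
  induction j using Fin.induction with
  | zero => exact ⟨mul_one _, fun k hk => by simp at hk, fun k hk => by simp at hk⟩
  | succ i ih =>
    obtain ⟨haa, hta, hbb⟩ := ih
    have hs : heckeGen q i * antisymmetrizer q p i.succ =
        (-q⁻¹) • antisymmetrizer q p i.succ := by
      rw [antisymmetrizer_succ, mul_smul_comm, smul_comm (-q⁻¹)]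
      congr 1
      -- The first antisymmetrizer is 1 and has no predecessor, so absorption into the second is
      -- checked directly.
      obtain ⟨_ | n, hn⟩ := i
      · have h1 : antisymmetrizer q p (Fin.castSucc ⟨0, hn⟩) = 1 := rfl
        rw [h1, qNumber_one hq0 hq]
        simp only [one_mul, mul_one, zero_add, pow_one, one_smul]
        exact hecke_absorb_one hq0 (heckeGen_sq hq0 _)
      · have hb := antisymmetrizer_succ (q := q) (p := p) ⟨n, by omega⟩
        have e1 : Fin.succ (⟨n, by omega⟩ : Fin p) = Fin.castSucc ⟨n + 1, hn⟩ := rfl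
        rw [e1] at hb
        set a := antisymmetrizer q p (Fin.castSucc ⟨n + 1, hn⟩) with ha
        set b := antisymmetrizer q p (Fin.castSucc (⟨n, by omega⟩ : Fin p)) with hb'
        have hba : b * a = a := by
          rw [hb, mul_smul_comm, mul_assoc, ← mul_assoc b b, hbb ⟨n, by omega⟩ rfl]
        have hab : qNumber q (n + 2) • a = b *
            (q ^ (n + 1) • 1 - qNumber q (n + 1) • heckeGen q (⟨n, by omega⟩ : Fin p)) * b := by
          rw [hb, smul_smul, mul_inv_cancel₀ (qNumber_ne_zero hq0 hq _), one_smul]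
        have := hecke_absorb hq0 haa hba hab
          (heckeGen_commute_antisymmetrizer ⟨n + 1, hn⟩ _ (by simp)).eq
          (hta ⟨n, by omega⟩ (by simp)) (heckeGen_braid _ _ rfl).symm (heckeGen_sq hq0 _)
        rwa [← pow_succ'] at this
    have hidem := isIdempotent_of_absorb hq0 hq _ haa (antisymmetrizer_succ i) hs
    refine ⟨hidem, fun k hk => ?_, fun k hk => by rw [Fin.succ_injective _ hk, haa]⟩
    rcases Nat.lt_or_ge k i with h | h
    · rw [antisymmetrizer_succ, mul_smul_comm, ← mul_assoc, ← mul_assoc, hta k (by simpa using h)]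
      rw [smul_mul_assoc, smul_mul_assoc, smul_comm]
    · have : k = i := Fin.ext (by simp at hk; omega)
      rw [this]
      exact hs

end Antisymmetrizer

/-! ### The q-Newton recursion for the antisymmetrizers. -/

section ElementarySymmetric

theorem extend_sub {N n : ℕ} {𝓐 : Type} [Ring 𝓐]
    (X Y : Matrix (Fin n → Fin N) (Fin n → Fin N) 𝓐) :
    extend (X - Y) = extend X - extend Y := by
  rw [eq_sub_iff_add_eq, ← extend_add, sub_add_cancel]

theorem sub_sum_smul {A ι : Type*} [Ring A] [Algebra ℂ A] (s : Finset ι) (y : A) (c : ι → ℂ)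
    (f : ι → A) : y - ∑ k ∈ s, c k • f k = (∑ k ∈ s, (-c k) • f k) + y := by
  simp only [neg_smul, Finset.sum_neg_distrib]
  abel

variable {N : ℕ} {q : ℂ} {R Ψ : Matrix (Fin N × Fin N) (Fin N × Fin N) ℂ}

theorem heckeRep_antisymmetrizer_castSucc (hR : IsHeckeSymmetry q R) {p : ℕ} (j : Fin (p + 1)) :
    heckeRep hR (p + 1) (antisymmetrizer q (p + 1) j.castSucc) =
      extend (heckeRep hR p (antisymmetrizer q p j)) := by
  induction j using Fin.induction with
  | zero =>
    change heckeRep hR (p + 1) 1 = extend (heckeRep hR p 1)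
    rw [map_one, map_one, extend_one]
  | succ i ih =>
    rw [← Fin.succ_castSucc, antisymmetrizer_succ, antisymmetrizer_succ]
    simp only [map_smul, map_mul, map_sub, map_one, heckeRep_heckeGen, ih, extend_smul,
      extend_mul, braidMatrix_castSucc, Fin.val_castSucc, extend_sub, extend_one]

theorem heckeRep_columnIdempotent_succ (hR : IsHeckeSymmetry q R) (p : ℕ) :
    heckeRep hR (p + 1) (columnIdempotent q (p + 1)) = (qNumber q (p + 2))⁻¹ •
      (extend (heckeRep hR p (columnIdempotent q p)) *
        (q ^ (p + 1) • 1 - qNumber q (p + 1) • braidMatrix R (Fin.last p)) *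
        extend (heckeRep hR p (columnIdempotent q p))) := by
  rw [columnIdempotent, ← Fin.succ_last, antisymmetrizer_succ]
  simp only [map_smul, map_mul, map_sub, map_one, heckeRep_heckeGen,
    heckeRep_antisymmetrizer_castSucc, Fin.val_last]
  rfl

theorem elemSym_succ (hR : IsHeckeSymmetry q R) (hq0 : q ≠ 0) (p : ℕ) :
    elemSym hR Ψ (p + 1) = hookTrace R Ψ p 1 (heckeRep hR p (columnIdempotent q p)) := by
  rw [elemSym, charMap, hookTrace_one hR hq0]

/-- The two terms of the antisymmetrizer's recursion fall under the two rules: the scalar term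
splits off a trace of a power, the braid term removes a factor. -/
theorem hookTrace_column_succ (hR : IsHeckeSymmetry q R) (hq0 : q ≠ 0)
    (hq : ∀ k : ℕ, 1 ≤ k → q ^ k ≠ 1) (hΨ : IsSkewInverse R Ψ) (p j : ℕ) :
    qNumber q (p + 2) •
        hookTrace R Ψ (p + 1) j (heckeRep hR (p + 1) (columnIdempotent q (p + 1))) =
      q ^ (p + 1) • (elemSym hR Ψ (p + 1) * tracePower R Ψ j) -
        qNumber q (p + 1) • hookTrace R Ψ p (j + 1) (heckeRep hR p (columnIdempotent q p)) := by
  have hz : heckeRep hR p (columnIdempotent q p) * heckeRep hR p (columnIdempotent q p) =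
      heckeRep hR p (columnIdempotent q p) := by
    rw [← map_mul, columnIdempotent, (antisymmetrizer_spec hq0 hq _).1]
  rw [heckeRep_columnIdempotent_succ, hookTrace_smul, smul_smul,
    mul_inv_cancel₀ (qNumber_ne_zero hq0 hq _), one_smul, mul_sub, sub_mul, mul_smul_comm,
    mul_smul_comm, mul_one, smul_mul_assoc, smul_mul_assoc, ← extend_mul, hz, hookTrace_sub,
    hookTrace_smul, hookTrace_smul, hookTrace_extend hR hq0 hΨ, ← elemSym_succ hR hq0,
    hookTrace_conj_braid hR hq0 hΨ p j hz]

theorem qNumber_smul_hookTrace_column (hR : IsHeckeSymmetry q R) (hq0 : q ≠ 0)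
    (hq : ∀ k : ℕ, 1 ≤ k → q ^ k ≠ 1) (hΨ : IsSkewInverse R Ψ) (p j : ℕ) :
    qNumber q (p + 1) • hookTrace R Ψ p j (heckeRep hR p (columnIdempotent q p)) =
      ∑ k ∈ Finset.range (p + 1),
        ((-1) ^ (p - k) * q ^ k) • (elemSym hR Ψ k * tracePower R Ψ (j + (p - k))) := by
  induction p generalizing j with
  | zero =>
    have h1 : heckeRep hR 0 (columnIdempotent q 0) = 1 := map_one _
    simp [h1, hookTrace_zero_one, elemSym, qNumber_one hq0 hq]
  | succ p ih =>
    rw [hookTrace_column_succ hR hq0 hq hΨ, ih, Finset.sum_range_succ _ (p + 1)]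
    refine (sub_sum_smul _ _ _ _).trans ?_
    congr 1
    · refine Finset.sum_congr rfl fun k hk => ?_
      have hk' : k ≤ p := by simpa [Nat.lt_succ_iff] using hk
      have e1 : p + 1 - k = (p - k) + 1 := by omega
      have e2 : j + 1 + (p - k) = j + (p - k + 1) := by ring
      rw [e1, e2, pow_succ]
      congr 1
      ring
    · simp

end ElementarySymmetric

/-! ### Vanishing of the higher elementary symmetric polynomials -/

section Vanishing

variable {N : ℕ} {q : ℂ} {R Ψ : Matrix (Fin N × Fin N) (Fin N × Fin N) ℂ}

/-- Families of tensors, one in each degree, annihilated by all the matrices `q⁻¹ + R_i`. -/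
def skewTensors (q : ℂ) (R : Matrix (Fin N × Fin N) (Fin N × Fin N) ℂ) :
    Submodule ℂ ((k : ℕ) → (Fin k → Fin N) → ℂ) where
  carrier := {ψ | ∀ (p : ℕ) (i : Fin p),
    Matrix.mulVec (braidMatrix (q⁻¹ • 1 + R) i) (ψ (p + 1)) = 0}
  add_mem' h h' p i := by rw [Pi.add_apply, Matrix.mulVec_add, h p i, h' p i, add_zero]
  zero_mem' p i := by rw [Pi.zero_apply, Matrix.mulVec_zero]
  smul_mem' c ψ h p i := by rw [Pi.smul_apply, Matrix.mulVec_smul, h p i, smul_zero]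

/-- Contraction of the last factor with the basis covector number `a`. -/
def contractLast (a : Fin N) :
    ((k : ℕ) → (Fin k → Fin N) → ℂ) →ₗ[ℂ] ((k : ℕ) → (Fin k → Fin N) → ℂ) where
  toFun ψ k w := ψ (k + 1) (addLeg w a)
  map_add' _ _ := rfl
  map_smul' _ _ := rfl

theorem contractLast_mem {ψ : (k : ℕ) → (Fin k → Fin N) → ℂ} (h : ψ ∈ skewTensors q R)
    (a : Fin N) : contractLast a ψ ∈ skewTensors q R := by
  intro p i
  funext w
  have h1 := congrFun (h (p + 1) i.castSucc) (addLeg w a)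
  rw [braidMatrix_castSucc] at h1
  rw [Pi.zero_apply] at h1 ⊢
  rw [← h1]
  simp [Matrix.mulVec, dotProduct, sum_addLeg, contractLast]

/-- The action of the generators of the `R`-skew-symmetric algebra on skew tensors. -/
def skewAction (q : ℂ) (R : Matrix (Fin N × Fin N) (Fin N × Fin N) ℂ) (a : Fin N) :
    Module.End ℂ (skewTensors q R) :=
  (contractLast a).restrict fun _ h => contractLast_mem h a

/-- The word acts by appending letters to the argument of a functional, so the value of the left
side at `w` is that of q⁻¹ + R on the last two legs, applied to `ψ`, at `w i j`. -/
theorem skewAction_rel (i j : Fin N) :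
    ∑ a, ∑ b, (q⁻¹ • (1 : Matrix (Fin N × Fin N) (Fin N × Fin N) ℂ) + R) (i, j) (a, b) •
      (skewAction q R a * skewAction q R b) = 0 := by
  refine LinearMap.ext fun ψ => Subtype.ext ?_
  funext k w
  have h1 := congrFun (ψ.2 (k + 1) (Fin.last k)) (addLeg (addLeg w i) j)
  simp only [Matrix.mulVec, dotProduct, sum_addLeg, braidMatrix_last_apply, Pi.zero_apply] at h1
  rw [Finset.sum_eq_single w (fun v _ hv => by simp [hv.symm]) (by simp)] at h1
  simp only [if_true] at h1
  simp only [LinearMap.sum_apply, LinearMap.smul_apply, Submodule.coe_sum, Submodule.coe_smul,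
    Finset.sum_apply, Pi.smul_apply, smul_eq_mul]
  exact h1

/-- The representation of the `R`-skew-symmetric algebra on skew tensors. -/
noncomputable def skewRep (q : ℂ) (R : Matrix (Fin N × Fin N) (Fin N × Fin N) ℂ) :
    SkewAlgebra q R →ₐ[ℂ] Module.End ℂ (skewTensors q R) :=
  RingQuot.liftAlgHom ℂ ⟨FreeAlgebra.lift ℂ (skewAction q R), by
    intro x y hxy
    cases hxy with
    | rel i j => simpa using skewAction_rel i j⟩

/-- A monomial that is zero in the algebra acts as zero, so this evaluation forces every skew tensor
to vanish on it. -/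
theorem skewAction_prod_apply (n : ℕ) (w : Fin n → Fin N) (ψ : skewTensors q R) :
    ((List.ofFn fun j => skewAction q R (w j)).prod ψ).1 0 Fin.elim0 = ψ.1 n w := by
  induction n generalizing ψ with
  | zero => simp [Subsingleton.elim w Fin.elim0]
  | succ n ih =>
    obtain ⟨w, a, rfl⟩ := exists_eq_addLeg w
    rw [List.ofFn_succ', List.concat_eq_append, List.prod_append, List.prod_singleton,
      Module.End.mul_apply]
    simp only [addLeg_castSucc, addLeg_last]
    rw [ih]
    rfl

theorem braidMatrix_mul_columnIdempotent (hR : IsHeckeSymmetry q R) (hq0 : q ≠ 0)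
    (hq : ∀ k : ℕ, 1 ≤ k → q ^ k ≠ 1) {p : ℕ} (i : Fin p) :
    braidMatrix (q⁻¹ • 1 + R) i * heckeRep hR p (columnIdempotent q p) = 0 := by
  have h1 : q⁻¹ • 1 + R = R - (-q⁻¹) • 1 := by rw [neg_smul, sub_neg_eq_add, add_comm]
  have h2 := congrArg (heckeRep hR p) ((antisymmetrizer_spec hq0 hq (Fin.last p)).2.1 i
    (by simp))
  rw [map_mul, map_smul, heckeRep_heckeGen] at h2
  rw [h1, braidMatrix_sub_smul_one, sub_mul, smul_mul_assoc, one_mul, columnIdempotent, h2,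
    sub_self]

/-- Absorption makes each column of the matrix a skew tensor. Its value at a word is read off from
the action of the corresponding monomial, which is zero by hypothesis. -/
theorem heckeRep_columnIdempotent_eq_zero (hR : IsHeckeSymmetry q R) (hq0 : q ≠ 0)
    (hq : ∀ k : ℕ, 1 ≤ k → q ^ k ≠ 1) {p : ℕ} (h : skewComponent q R (p + 1) = ⊥) :
    heckeRep hR p (columnIdempotent q p) = 0 := by
  ext w g
  -- Column `g` placed in degree `p + 1`, with zero in every other degree.
  set ψ : (k : ℕ) → (Fin k → Fin N) → ℂ :=
    Pi.single (p + 1) fun w => heckeRep hR p (columnIdempotent q p) w g with hψ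
  have hmem : ψ ∈ skewTensors q R := by
    intro p' i
    by_cases hp : p' = p
    · subst hp
      rw [hψ, Pi.single_eq_same]
      funext v
      exact congrFun (congrFun (braidMatrix_mul_columnIdempotent hR hq0 hq i) v) g
    · rw [hψ, Pi.single_eq_of_ne (by omega), Matrix.mulVec_zero]
  have h1 := skewAction_prod_apply (p + 1) w ⟨ψ, hmem⟩
  have h2 : (List.ofFn fun j => RingQuot.mkAlgHom ℂ (SkewRel q R)
      (FreeAlgebra.ι ℂ (w j))).prod = 0 := by
    have h3 : _ ∈ skewComponent q R (p + 1) := Submodule.subset_span (Set.mem_range_self w)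
    rw [h] at h3
    exact (Submodule.mem_bot ℂ).mp h3
  have h3 := congrArg (skewRep q R) h2
  rw [map_list_prod, List.map_ofFn, map_zero] at h3
  have h4 : (skewRep q R ∘ fun j => RingQuot.mkAlgHom ℂ (SkewRel q R) (FreeAlgebra.ι ℂ (w j))) =
      fun j => skewAction q R (w j) := by
    funext j
    simp [skewRep]
  rw [h4] at h3
  rw [h3] at h1
  simp only [hψ, Pi.single_eq_same] at h1
  exact h1.symm

theorem IsEvenOfBirank.skewComponent_eq_bot {m : ℕ} (hm : IsEvenOfBirank q R m) {n : ℕ}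
    (hn : m < n) : skewComponent q R n = ⊥ := by
  obtain ⟨h, hd, hh⟩ := hm.degree
  have h1 := congrArg (PowerSeries.coeff n) hh
  rw [Polynomial.coeff_coe, Polynomial.coeff_eq_zero_of_degree_lt (by rw [hd]; exact_mod_cast hn),
    skewHilbertSeries, PowerSeries.coeff_mk] at h1
  -- `finrank` is also 0 for infinite-dimensional modules; finiteness is what makes rank 0 mean
  -- zero.
  have := hm.finite
  exact Submodule.finrank_eq_zero.mp h1.symm

theorem elemSym_eq_zero {m : ℕ} (hR : IsHeckeSymmetry q R) (hq0 : q ≠ 0)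
    (hq : ∀ k : ℕ, 1 ≤ k → q ^ k ≠ 1) (hm : IsEvenOfBirank q R m) {n : ℕ} (hn : m < n) :
    elemSym hR Ψ n = 0 := by
  obtain ⟨p, rfl⟩ : ∃ p, n = p + 1 := ⟨n - 1, by omega⟩
  rw [elemSym_succ hR hq0,
    heckeRep_columnIdempotent_eq_zero hR hq0 hq (hm.skewComponent_eq_bot hn)]
  simp [hookTrace, scalarMatrix, rTrace]

end Vanishing

/-! ### Generating functions -/

section SubstScalar

variable {𝓐 : Type} [Ring 𝓐] [Algebra ℂ 𝓐]

theorem coeff_substScalar (c : ℂ) (F : PowerSeries 𝓐) (n : ℕ) :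
    PowerSeries.coeff n (substScalar c F) = c ^ n • PowerSeries.coeff n F :=
  PowerSeries.coeff_mk _ _

theorem substScalar_add (c : ℂ) (F G : PowerSeries 𝓐) :
    substScalar c (F + G) = substScalar c F + substScalar c G := by
  ext n
  simp only [coeff_substScalar, map_add, smul_add]

theorem coeff_complex_smul (c : ℂ) (F : PowerSeries 𝓐) (n : ℕ) :
    PowerSeries.coeff n (c • F) = c • PowerSeries.coeff n F :=
  rfl

theorem substScalar_smul (c d : ℂ) (F : PowerSeries 𝓐) :
    substScalar c (d • F) = d • substScalar c F := by
  ext n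
  simp only [coeff_substScalar, coeff_complex_smul]
  rw [smul_comm]

theorem substScalar_mul (c : ℂ) (F G : PowerSeries 𝓐) :
    substScalar c (F * G) = substScalar c F * substScalar c G := by
  ext n
  simp only [coeff_substScalar, PowerSeries.coeff_mul, Finset.smul_sum]
  refine Finset.sum_congr rfl fun x hx => ?_
  rw [smul_mul_smul_comm, ← pow_add, show x.1 + x.2 = n by simpa using hx]

/-- The hypothesis says that 1 - ωT is a left inverse of 1 + ωP, which has constant term 1 and hence
a right inverse. The two inverses agree, so the factors may be exchanged. -/
theorem eq_add_smul_mul_of_eq_add_smul_mul {ω : ℂ} (hω : ω ≠ 0) {P T : PowerSeries 𝓐}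
    (h0 : PowerSeries.constantCoeff P = 0) (h : P = T + ω • (T * P)) : P = T + ω • (P * T) := by
  have h1 : (1 - ω • T) * (1 + ω • P) = 1 := by
    have h2 : P - ω • (T * P) = T := sub_eq_of_eq_add h
    simp only [sub_mul, mul_add, one_mul, mul_one, smul_mul_assoc, mul_smul_comm]
    rw [h2, sub_add_cancel]
  have h3 : PowerSeries.constantCoeff (1 + ω • P) = ((1 : 𝓐ˣ) : 𝓐) := by
    have h4 : PowerSeries.constantCoeff (ω • P) = 0 := by
      rw [← PowerSeries.coeff_zero_eq_constantCoeff_apply] at h0 ⊢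
      rw [coeff_complex_smul, h0, smul_zero]
    rw [map_add, map_one, h4, add_zero, Units.val_one]
  have h4 := PowerSeries.mul_invOfUnit _ _ h3
  have h5 := left_inv_eq_right_inv h1 h4
  rw [← h5] at h4
  have h6 : ω • (P - (T + ω • (P * T))) = 0 := by
    simp only [add_mul, mul_sub, one_mul, mul_one, smul_mul_assoc, mul_smul_comm] at h4
    simp only [smul_sub, smul_add] at h4 ⊢
    rw [← sub_eq_zero] at h4
    rw [← h4]
    abel
  exact sub_eq_zero.mp ((smul_eq_zero.mp h6).resolve_left hω)

end SubstScalar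

/-! ### The relations coefficient by coefficient. -/

section Generating

variable {N m : ℕ} {q : ℂ} {R Ψ : Matrix (Fin N × Fin N) (Fin N × Fin N) ℂ}

/-- Truncation at `m` loses nothing, because the higher elementary symmetric polynomials vanish. -/
theorem coeff_genA (hR : IsHeckeSymmetry q R) (hq0 : q ≠ 0)
    (hq : ∀ k : ℕ, 1 ≤ k → q ^ k ≠ 1) (hm : IsEvenOfBirank q R m) (n : ℕ) :
    PowerSeries.coeff n (genA hR Ψ m) = elemSym hR Ψ n := by
  rw [genA, map_add, map_sum]
  simp only [PowerSeries.coeff_monomial, PowerSeries.coeff_one]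
  rw [Finset.sum_ite_eq]
  rcases Nat.eq_zero_or_pos n with rfl | hn
  · simp [elemSym]
  · by_cases hnm : n ≤ m
    · rw [if_pos (Finset.mem_Icc.mpr ⟨hn, hnm⟩), if_neg hn.ne', zero_add]
    · rw [if_neg hn.ne', if_neg (by simp [hnm]), zero_add,
        elemSym_eq_zero hR hq0 hq hm (by omega)]

theorem coeff_genP (hR : IsHeckeSymmetry q R) (n : ℕ) :
    PowerSeries.coeff n (genP hR Ψ) = powerSumFirst hR Ψ n := by
  rw [genP, PowerSeries.coeff_mk]
  cases n <;> simp [powerSumFirst]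

theorem coeff_genT (hR : IsHeckeSymmetry q R) (n : ℕ) :
    PowerSeries.coeff n (genT hR Ψ) = powerSumSecond hR Ψ n := by
  rw [genT, PowerSeries.coeff_mk]
  cases n <;> simp [powerSumSecond]

theorem qNumber_smul_elemSym (hR : IsHeckeSymmetry q R) (hq0 : q ≠ 0)
    (hq : ∀ k : ℕ, 1 ≤ k → q ^ k ≠ 1) (hΨ : IsSkewInverse R Ψ) (p : ℕ) :
    qNumber q (p + 1) • elemSym hR Ψ (p + 1) = ∑ k ∈ Finset.range (p + 1),
      ((-1) ^ (p - k) * q ^ k) • (elemSym hR Ψ k * powerSumFirst hR Ψ (p + 1 - k)) := by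
  rw [elemSym_succ hR hq0, qNumber_smul_hookTrace_column hR hq0 hq hΨ]
  refine Finset.sum_congr rfl fun k hk => ?_
  have hk' : k ≤ p := Nat.lt_succ_iff.mp (Finset.mem_range.mp hk)
  rw [show p + 1 - k = p - k + 1 by omega, powerSumFirst_eq_tracePower hR hq0 hΨ, add_comm 1]

/-- The term `k = p + 1` drops out as `x 0 = 0`. The remaining signs differ from those of the Newton
identity by one factor -1, whence the order of the difference. -/
theorem sum_smul_mul_smul {A : Type*} [Ring A] [Algebra ℂ A] {c d d' w : ℂ} (p : ℕ) {q : ℂ}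
    {a x : ℕ → A} (hx : x 0 = 0) (hc : w * c = d - d')
    (h : c • a (p + 1) = ∑ k ∈ Finset.range (p + 1),
      ((-1) ^ (p - k) * q ^ k) • (a k * x (p + 1 - k))) :
    w • ∑ k ∈ Finset.range (p + 1).succ,
      (q ^ k • a k) * ((-1 : ℂ) ^ (p + 1 - k) • x (p + 1 - k)) = d' • a (p + 1) - d • a (p + 1) := by
  have h1 : ∑ k ∈ Finset.range (p + 1),
      (q ^ k • a k) * ((-1 : ℂ) ^ (p + 1 - k) • x (p + 1 - k)) = (-c) • a (p + 1) := by
    rw [neg_smul, h, ← Finset.sum_neg_distrib]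
    refine Finset.sum_congr rfl fun k hk => ?_
    have hk' : k ≤ p := Nat.lt_succ_iff.mp (Finset.mem_range.mp hk)
    rw [smul_mul_smul_comm, ← neg_smul]
    congr 1
    rw [show p + 1 - k = p - k + 1 by omega, pow_succ]
    ring
  rw [Nat.succ_eq_add_one, Finset.sum_range_succ, h1, Nat.sub_self, hx, smul_zero, mul_zero,
    add_zero, smul_smul, mul_neg, hc, neg_sub, sub_smul]

theorem newton_first (hR : IsHeckeSymmetry q R) (hq0 : q ≠ 0)
    (hq : ∀ k : ℕ, 1 ≤ k → q ^ k ≠ 1) (hΨ : IsSkewInverse R Ψ) (hm : IsEvenOfBirank q R m) :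
    (q - q⁻¹) • (substScalar q (genA hR Ψ m) * substScalar (-1) (genP hR Ψ)) =
      substScalar q⁻¹ (genA hR Ψ m) - substScalar q (genA hR Ψ m) := by
  ext n
  rw [coeff_complex_smul, PowerSeries.coeff_mul, map_sub]
  simp only [coeff_substScalar, coeff_genA hR hq0 hq hm, coeff_genP]
  rw [Finset.Nat.sum_antidiagonal_eq_sum_range_succ fun i j =>
    (q ^ i • elemSym hR Ψ i) * ((-1 : ℂ) ^ j • powerSumFirst hR Ψ j)]
  cases n with
  | zero => simp [powerSumFirst]
  | succ p =>
    exact sum_smul_mul_smul p rfl ((mul_comm _ _).trans (qNumber_mul hq0 hq _))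
      (qNumber_smul_elemSym hR hq0 hq hΨ p)

theorem genP_eq (hR : IsHeckeSymmetry q R) (hq0 : q ≠ 0) (hΨ : IsSkewInverse R Ψ) :
    genP hR Ψ = genT hR Ψ + (q - q⁻¹) • (genT hR Ψ * genP hR Ψ) := by
  ext n
  rw [map_add, coeff_complex_smul, PowerSeries.coeff_mul]
  simp only [coeff_genT, coeff_genP]
  rw [Finset.Nat.sum_antidiagonal_eq_sum_range_succ fun i j =>
    powerSumSecond hR Ψ i * powerSumFirst hR Ψ j]
  cases n with
  | zero => simp [powerSumFirst, powerSumSecond]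
  | succ p =>
    have h0 : powerSumFirst hR Ψ 0 = 0 := rfl
    have h1 : powerSumSecond hR Ψ 0 = 0 := rfl
    -- Both end terms of the convolution vanish since the values at 0 are 0; the rest is reindexed
    -- by one.
    rw [powerSumFirst_eq_tracePower hR hq0 hΨ, tracePower_eq_powerSumSecond_add hR hq0 hΨ,
      Nat.succ_eq_add_one, Finset.sum_range_succ, Nat.sub_self, h0, mul_zero, add_zero,
      Finset.sum_range_succ', h1, zero_mul, add_zero]
    congr 2
    refine Finset.sum_congr rfl fun k hk => ?_
    have hk' := Finset.mem_range.mp hk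
    rw [show p + 1 - (k + 1) = (p - k - 1) + 1 by omega, show p - k = (p - k - 1) + 1 by omega,
      powerSumFirst_eq_tracePower hR hq0 hΨ]
    rfl

/-- The first hypothesis reads B = A(1 + ωP) and the second (1 + ωP)T = P, so ωBT = ωAP. -/
theorem smul_mul_eq_of_eq_add {𝓐 : Type} [Ring 𝓐] [Algebra ℂ 𝓐] {ω : ℂ}
    {A B P T : PowerSeries 𝓐} (h1 : ω • (A * P) = B - A) (h2 : P = T + ω • (P * T)) :
    ω • (B * T) = B - A := by
  have h3 : B = A + ω • (A * P) := by rw [h1, add_sub_cancel]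
  calc ω • (B * T) = ω • (A * (T + ω • (P * T))) := by
        conv_lhs => rw [h3]
        simp only [add_mul, mul_add, smul_mul_assoc, mul_smul_comm, mul_assoc]
    _ = B - A := by rw [← h2, h1]

end Generating

theorem mainTheorem5 (N m : ℕ) (q : ℂ) (hq0 : q ≠ 0) (hq : ∀ k : ℕ, 1 ≤ k → q ^ k ≠ 1)
    (R Ψ : Matrix (Fin N × Fin N) (Fin N × Fin N) ℂ)
    (hR : IsHeckeSymmetry q R) (hΨ : IsSkewInverse R Ψ) (hm : IsEvenOfBirank q R m) :
    (q - q⁻¹) • (substScalar q (genA hR Ψ m) * substScalar (-1) (genP hR Ψ)) =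
        substScalar q⁻¹ (genA hR Ψ m) - substScalar q (genA hR Ψ m) ∧
      (q - q⁻¹) • (substScalar q⁻¹ (genA hR Ψ m) * substScalar (-1) (genT hR Ψ)) =
        substScalar q⁻¹ (genA hR Ψ m) - substScalar q (genA hR Ψ m) ∧
      genP hR Ψ = genT hR Ψ + (q - q⁻¹) • (genP hR Ψ * genT hR Ψ) := by
  have h1 := newton_first hR hq0 hq hΨ hm
  have h0 : PowerSeries.constantCoeff (genP hR Ψ) = 0 := by
    rw [← PowerSeries.coeff_zero_eq_constantCoeff_apply, coeff_genP]
    rfl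
  have h3 := eq_add_smul_mul_of_eq_add_smul_mul (sub_inv_ne_zero_of_generic hq0 hq) h0
    (genP_eq hR hq0 hΨ)
  refine ⟨h1, smul_mul_eq_of_eq_add h1 ?_, h3⟩
  -- The substitution x ↦ -x is multiplicative, so the relation between P and T also holds at -x.
  have h4 := congrArg (substScalar (-1)) h3
  rwa [substScalar_add, substScalar_smul, substScalar_mul] at h4
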